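/- **Proposition C.1 (nodal density and spin operators).** Let $L>0$ and $\tilde a>0$ be such that $L/\tilde a$ is a positive integer. Write vectors of $\mathbb R^2$ as ${\bf k}=k_+{\bf e}_++k_-{\bf e}_-$ and for $s=\pm$ put $$\Lambda_s^*=\Bigl\{{\bf k}: k_\pm\in\tfrac{2\pi}{L}(\mathbb Z+\tfrac12),\ -\tfrac{\pi}{\tilde a}\le k_{-s}<\tfrac{\pi}{\tilde a}\Bigr\},\qquad \tilde\Lambda^*=\bigl\{{\bf p}: p_\pm\in\tfrac{2\pi}{L}\mathbb Z\bigr\}.$$ Let $\mathcal F$ be the fermion Fock space over the Dirac vacuum $\Omega$, $\|\Omega\|=1$, with fermion operators $\hat\psi_{r,s,\alpha}({\bf k})$ ($r,s=\pm$, spin $\alpha=\pm$, ${\bf k}\in\Lambda_s^*$) satisfying $\{\hat\psi_{r,s,\alpha}({\bf k}),\hat\psi^\dagger_{r',s',\alpha'}({\bf k}')\}=(L/2\pi)^2\delta_{r,r'}\delta_{s,s'}\delta_{\alpha,\alpha'}\delta_{{\bf k},{\bf k}'}$, $\{\hat\psi,\hat\psi\}=0$, and $\hat\psi_{r,s,\alpha}({\bf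 k})\Omega=0$ if $rk_s>0$, $\hat\psi^\dagger_{r,s,\alpha}({\bf k})\Omega=0$ if $rk_s<0$. Let $\mathcal D\subset\mathcal F$ be the linear span of the occupation-number basis vectors with finitely many particle and hole excitations of $\Omega$. Write $:\!O\!:\,=O-\langle\Omega,O\Omega\rangle$ for fermion bilinears $O$, let $\sigma^0=1$ and let $\sigma^1,\sigma^2,\sigma^3$ be the Pauli matrices. For $r,s=\pm$, $\mu=0,1,2,3$ and ${\bf p}\in\tilde\Lambda^*$ consider $$\hat J^\mu_{r,s}({\bf p})=\sum_{\alpha,\beta}\ \sum_{{\bf k}_1,{\bf k}_2\in\Lambda_s^*}\ \sum_{n\in\mathbb Z}\Bigl(\frac{2\pi}{L}\Bigr)^2:\!\hat\psi^\dagger_{r,s,\alpha}({\bf k}_1)\,\sigma^\mu_{\alpha,\beta}\,\hat\psi_{r,s,\beta}({\bf k}_2)\!:\ \delta_{{\bf k}_1+{\bf p},\,{\bf k}_2+2\pi n{\bf e}_{-s}/\tilde a},$$ and $\hat J_{r,s}=\hat J^0_{r,s}$, $\hat S^i_{r,s}=\tfrac12\hat J^i_{r,s}$ for $i=1,2,3$.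 Then: 1. These operators are well defined: $\mathcal D$ is dense and contains $\Omega$; the series converges unconditionally in norm on every vector of $\mathcal D$; the operator it defines on the space of all vectors on which it converges in this sense is closable; and $\mathcal D$ is a core of its closure, which is again denoted $\hat J^\mu_{r,s}({\bf p})$. The operators $\hat J_{r,s}({\bf p})$ and $\hat S^i_{r,s}({\bf p})$ map $\mathcal D$ into $\mathcal D$. 2. On $\mathcal D$, for all ${\bf p},{\bf p}'\in\tilde\Lambda^*$ (with $\epsilon_{ijk}$ totally antisymmetric, $\epsilon_{123}=1$), $$[\hat J_{r,s}({\bf p}),\hat J_{r,s}({\bf p}')]=r\frac{4\pi p_s}{\tilde a}\Bigl(\frac{L}{2\pi}\Bigr)^2\sum_{n\in\mathbb Z}\delta_{{\bf p}+{\bf p}',\,2\pi n{\bf e}_{-s}/\tilde a},$$ $$[\hat S^i_{r,s}({\bf p}),\hat S^j_{r,s}({\bf p}')]=\mathrm i\sum_{k=1}^3\epsilon_{ijk}\hat S^k_{r,s}({\bf p}+{\bf p}')+\delta_{i,j}\,r\frac{\pi p_s}{\tilde a}\Bigl(\frac{L}{2\pi}\Bigr)^2\sum_{n\in\mathbb Z}\delta_{{\bf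 p}+{\bf p}',\,2\pi n{\bf e}_{-s}/\tilde a},$$ and all other commutators vanish: $[\hat J_{r,s}({\bf p}),\hat S^i_{r',s'}({\bf p}')]=0$ for all $r,s,r',s'$, and $[\hat J_{r,s}({\bf p}),\hat J_{r',s'}({\bf p}')]=0=[\hat S^i_{r,s}({\bf p}),\hat S^j_{r',s'}({\bf p}')]$ whenever $(r,s)\ne(r',s')$. 3. $\hat J_{r,s}({\bf p})^\dagger=\hat J_{r,s}(-{\bf p})$ and $\hat S^i_{r,s}({\bf p})^\dagger=\hat S^i_{r,s}(-{\bf p})$ as closed operators, for all ${\bf p}\in\tilde\Lambda^*$. 4. $\hat J_{r,s}({\bf p})\Omega=0$ and $\hat S^i_{r,s}({\bf p})\Omega=0$ for all ${\bf p}\in\tilde\Lambda^*$ with $rp_s\ge0$. -/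

import Mathlib

open scoped InnerProductSpace ENNReal

noncomputable section

/-! ### Fermion Fock space over a set of one-particle states -/

/-- The Hilbert space `ℓ²(Finset ι)`: the fermion (antisymmetric) Fock space over `ℓ²(ι)` in the
occupation-number representation.  A finite set `S` of one-particle states stands for the basis
vector in which exactly the states of `S` are occupied. -/
abbrev FockSpace (ι : Type) : Type := lp (fun _ : Finset ι => ℂ) 2

open Classical in
/-- The Jordan-Wigner sign `(-1)^#{x ∈ S | x < m}` with respect to a fixed well-order of `ι`. -/
def jwSign {ι : Type} (m : ι) (S : Finset ι) : ℂ :=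
  (-1) ^ (S.filter (fun x => WellOrderingRel x m)).card

open Classical in
/-- Coordinates of the image of `f` under the annihilation operator of the state `m`. -/
def annihilateFun {ι : Type} (m : ι) (f : Finset ι → ℂ) : Finset ι → ℂ :=
  fun S => if m ∈ S then 0 else jwSign m S * f (insert m S)

theorem sum_annihilateFun_le {ι : Type} (m : ι) (f : FockSpace ι) (s : Finset (Finset ι)) :
    ∑ S ∈ s, ‖annihilateFun m f S‖ ^ (2 : ℝ≥0∞).toReal ≤ ‖f‖ ^ (2 : ℝ≥0∞).toReal := by
  classical
  have h2 : (0 : ℝ) < (2 : ℝ≥0∞).toReal := by norm_num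
  have hinj : Set.InjOn (fun S : Finset ι => insert m S) (s.filter (fun S => m ∉ S)) := by
    intro S hS T hT h
    simp only [Finset.coe_filter, Set.mem_ofPred_eq] at hS hT
    have := congrArg (fun U => Finset.erase U m) h
    simpa [Finset.erase_insert hS.2, Finset.erase_insert hT.2] using this
  calc ∑ S ∈ s, ‖annihilateFun m f S‖ ^ (2 : ℝ≥0∞).toReal
      = ∑ S ∈ s.filter (fun S => m ∉ S), ‖f (insert m S)‖ ^ (2 : ℝ≥0∞).toReal := by
        rw [Finset.sum_filter]
        refine Finset.sum_congr rfl fun S _ => ?_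
        by_cases h : m ∈ S
        · simp [annihilateFun, h]
        · simp [annihilateFun, h, jwSign]
    _ = ∑ T ∈ (s.filter (fun S => m ∉ S)).image (fun S => insert m S),
          ‖f T‖ ^ (2 : ℝ≥0∞).toReal := by
        rw [Finset.sum_image hinj]
    _ ≤ ‖f‖ ^ (2 : ℝ≥0∞).toReal := lp.sum_rpow_le_norm_rpow h2 f _

/-- The (bounded) annihilation operator of the one-particle state `m`.
Its adjoint is the creation operator. -/
def annihilate {ι : Type} (m : ι) : FockSpace ι →L[ℂ] FockSpace ι :=
  LinearMap.mkContinuous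
    { toFun := fun f => ⟨annihilateFun m f, memℓp_gen' (sum_annihilateFun_le m f)⟩
      map_add' := by
        intro f g
        ext S
        change annihilateFun m (f + g : FockSpace ι) S = annihilateFun m f S + annihilateFun m g S
        by_cases h : m ∈ S <;> simp [annihilateFun, h, mul_add]
      map_smul' := by
        intro c f
        ext S
        by_cases h : m ∈ S <;> simp [annihilateFun, h, mul_left_comm] }
    1 (by
      intro f
      rw [one_mul]
      exact lp.norm_le_of_forall_sum_le (by norm_num) (norm_nonneg f)
        (sum_annihilateFun_le m f))

open Classical in
/-- The basis vector with occupied set `S`. -/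
def occVec {ι : Type} (S : Finset ι) : FockSpace ι := lp.single 2 S (1 : ℂ)

/-! ### Momenta.  Vectors of the plane are written in the basis `e₊, e₋`,
so that `k s` is the component `k_s` for `s = ±`. -/

/-- The unit vector `e_s`. -/
def unitVec (s : ℤˣ) : ℤˣ → ℝ := Pi.single s 1

/-- Fermion momenta: both components lie in `(2π/L)(ℤ + 1/2)`, and `-π/a ≤ k_{-s} < π/a`. -/
def fermionMomenta (L a : ℝ) (s : ℤˣ) : Set (ℤˣ → ℝ) :=
  {k | (∀ t, ∃ m : ℤ, k t = 2 * Real.pi / L * (m + 1 / 2)) ∧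
    -(Real.pi / a) ≤ k (-s) ∧ k (-s) < Real.pi / a}

/-- Boson momenta: both components lie in `(2π/L)ℤ`. -/
def bosonMomenta (L : ℝ) : Set (ℤˣ → ℝ) :=
  {p | ∀ t, ∃ m : ℤ, p t = 2 * Real.pi / L * m}

/-- Labels of the nodal one-particle states: chirality `r`, Fermi arc index `s`,
spin `α` (`0` is up, `1` is down) and momentum `k`. -/
structure NodalMode (L a : ℝ) where
  r : ℤˣ
  s : ℤˣ
  α : Fin 2
  k : fermionMomenta L a s

/-! ### Nodal fermions and the Dirac vacuum -/

/-- The nodal fermion Fock space built on the Dirac vacuum; a finite set of modes is now a set of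
excitations (particles if `r k_s > 0`, holes if `r k_s < 0`). -/
abbrev NodalFock (L a : ℝ) : Type := FockSpace (NodalMode L a)

/-- The Dirac vacuum `Ω`: no excitations. -/
def diracVacuum (L a : ℝ) : NodalFock L a := occVec ∅

/-- The span of the vectors with finitely many excitations. -/
def finiteExcitations (L a : ℝ) : Submodule ℂ (NodalFock L a) :=
  Submodule.span ℂ (Set.range occVec)

open Classical in
/-- The nodal fermion operator `ψ̂_{r,s,α}(k)`, normalized by
`{ψ̂(k), ψ̂†(k')} = (L/2π)² δ`: it annihilates a particle if `r k_s > 0` and creates a hole if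
`r k_s < 0`. -/
def nodalFermion (L a : ℝ) (r s : ℤˣ) (α : Fin 2) (k : fermionMomenta L a s) :
    NodalFock L a →L[ℂ] NodalFock L a :=
  ((L / (2 * Real.pi) : ℝ) : ℂ) •
    (if 0 < ((r : ℤ) : ℝ) * k.1 s then annihilate ⟨r, s, α, k⟩
      else ContinuousLinearMap.adjoint (annihilate ⟨r, s, α, k⟩))

/-- Normal ordering of a fermion bilinear: `:O: = O - ⟨Ω, O Ω⟩`. -/
def normalOrder {L a : ℝ} (O : NodalFock L a →L[ℂ] NodalFock L a) :
    NodalFock L a →L[ℂ] NodalFock L a :=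
  O - ⟪diracVacuum L a, O (diracVacuum L a)⟫_ℂ • ContinuousLinearMap.id ℂ (NodalFock L a)

/-- `σ⁰ = 1` and the Pauli matrices `σ¹, σ², σ³`. -/
def pauli : Fin 4 → Matrix (Fin 2) (Fin 2) ℂ :=
  ![1, !![0, 1; 1, 0], !![0, -Complex.I; Complex.I, 0], !![1, 0; 0, -1]]

/-- The totally antisymmetric tensor with `ε₁₂₃ = 1` (the indices run over `0, 1, 2` here). -/
def leviCivita (i j k : Fin 3) : ℂ :=
  (((j : ℕ) : ℂ) - ((i : ℕ) : ℂ)) * (((k : ℕ) : ℂ) - ((i : ℕ) : ℂ)) *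
    (((k : ℕ) : ℂ) - ((j : ℕ) : ℂ)) / 2

/-! ### Density and spin operators -/

/-- Summation indices `(α, β, k₁, k₂, n)` of the nodal bilinears. -/
abbrev BilinearIndex (L a : ℝ) (s : ℤˣ) : Type :=
  Fin 2 × Fin 2 × fermionMomenta L a s × fermionMomenta L a s × ℤ

open Classical in
/-- The summand
`(2π/L)² :ψ̂†_{r,s,α}(k₁) σ^μ_{αβ} ψ̂_{r,s,β}(k₂): δ_{k₁ + p, k₂ + 2πn e_{-s}/a}`. -/
def bilinearTerm (L a : ℝ) (μ : Fin 4) (r s : ℤˣ) (p : ℤˣ → ℝ) :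
    BilinearIndex L a s → (NodalFock L a →L[ℂ] NodalFock L a)
  | (α, β, k₁, k₂, n) =>
    if k₁.1 + p = k₂.1 + (2 * Real.pi * n / a) • unitVec (-s) then
      (((2 * Real.pi / L) ^ 2 : ℝ) : ℂ) •
        normalOrder (pauli μ α β •
          (ContinuousLinearMap.adjoint (nodalFermion L a r s α k₁) ∘L nodalFermion L a r s β k₂))
    else 0

/-- The infinite sum of the bilinears as an unbounded operator: its domain consists of all vectors
on which the series converges (unconditionally, in norm). -/
def bilinearSeries (L a : ℝ) (μ : Fin 4) (r s : ℤˣ) (p : ℤˣ → ℝ) :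
    NodalFock L a →ₗ.[ℂ] NodalFock L a where
  domain :=
    { carrier := {φ | Summable fun i => bilinearTerm L a μ r s p i φ}
      zero_mem' := by simp [summable_zero]
      add_mem' := by
        intro φ χ h₁ h₂
        simpa using Summable.add h₁ h₂
      smul_mem' := by
        intro c φ h
        simpa using Summable.const_smul c h }
  toFun :=
    { toFun := fun φ => ∑' i, bilinearTerm L a μ r s p i φ
      map_add' := by
        intro φ χ
        simpa using Summable.tsum_add φ.2 χ.2
      map_smul' := by
        intro c φ
        simpa using Summable.tsum_const_smul c φ.2 }

/-- The nodal current `Ĵ^μ_{r,s}(p)`, the closed operator given by the series. -/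
def nodalCurrent (L a : ℝ) (μ : Fin 4) (r s : ℤˣ) (p : ℤˣ → ℝ) :
    NodalFock L a →ₗ.[ℂ] NodalFock L a :=
  (bilinearSeries L a μ r s p).closure

/-- The nodal density operator `Ĵ_{r,s}(p) = Ĵ⁰_{r,s}(p)`. -/
def nodalDensity (L a : ℝ) (r s : ℤˣ) (p : ℤˣ → ℝ) : NodalFock L a →ₗ.[ℂ] NodalFock L a :=
  nodalCurrent L a 0 r s p

/-- The nodal spin operators `Ŝ^i_{r,s}(p) = Ĵ^i_{r,s}(p) / 2`, `i = 1, 2, 3`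
(the index runs over `0, 1, 2` here). -/
def nodalSpin (L a : ℝ) (i : Fin 3) (r s : ℤˣ) (p : ℤˣ → ℝ) :
    NodalFock L a →ₗ.[ℂ] NodalFock L a :=
  (1 / 2 : ℂ) • nodalCurrent L a i.succ r s p

/-! ### Unbounded operators on common domains -/

open Classical in
/-- The value of an unbounded operator at a vector (only used for vectors in the domain). -/
def act {E : Type} [AddCommGroup E] [Module ℂ E] (A : E →ₗ.[ℂ] E) (φ : E) : E :=
  if h : φ ∈ A.domain then A ⟨φ, h⟩ else 0

/-- The commutator `[A, B]` evaluated at a vector. -/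
def commAt {E : Type} [AddCommGroup E] [Module ℂ E] (A B : E →ₗ.[ℂ] E) (φ : E) : E :=
  act A (act B φ) - act B (act A φ)

/-- `∑_{n ∈ ℤ} δ_{q, 2πn e_{-s}/a}`. -/
def umklappDelta (a : ℝ) (s : ℤˣ) (q : ℤˣ → ℝ) : ℂ :=
  open Classical in ∑' n : ℤ, if q = (2 * Real.pi * n / a) • unitVec (-s) then 1 else 0

end

/-! The currents are second quantizations Q(U) = ∑ U(x,y) :b†(x) b(y): of one-particle matrices U
that act by σ on spin and by translation by p, modulo the reciprocal vectors 2πn e_{-s}/a, on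
momentum (`bilinearSeries_eq`). With one-particle energy e = r k_s, two facts drive everything: such
a U shifts e by exactly -r p_s (`shiftsBy_nodalMatrix`), and only finitely many modes lie below a
given |e|, because k_{-s} takes just M = L/a values (`finite_modeEnergy_le`).

On a basis vector a normal-ordered bilinear vanishes unless it removes an existing excitation or
creates a particle-hole pair. With the energy transfer fixed, only finitely many terms survive
(`exists_bound_of_normalBilinear_ne_zero`), so on finite vectors every series is a finite sum below
an energy cutoff. There the anticommutation relations give [Q(U),Q(V)] = Q(UV) - Q(VU) + κ with κ =
∑ U(x,y) V(y,x) (n(x) - n(y)), where n is the occupation of the Dirac sea (`secondQuant_comm`). For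
nodal matrices translations compose, since each k + p has exactly one representative in the zone;
hence UV - VU only sees [σ,τ]. The Schwinger term κ is a spectral flow: shifting the levels by l
contributes r l (`hasSum_levelOcc_sub`), once for each of the M transverse momenta, with weight
tr(στ).

For closures and adjoints, Q(U) shifts the total excitation energy by a constant, and each energy
value is attained by finitely many basis vectors. Truncating a vector in the domain of an adjoint to
finitely many energies truncates its image compatibly, so the graph is approximated by finite
vectors (`adjoint_eq_closure_of_shift`). The series operator on its maximal domain is then
sandwiched between its restriction to finite vectors and the closure of that restriction; this gives
closability, the core and the adjoint. The vacuum is annihilated for r p_s ≥ 0 because creating a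
pair needs a positive energy transfer. -/

noncomputable section

/-! ### Canonical anticommutation relations in the occupation-number representation. -/

section Fock

open Classical ContinuousLinearMap

variable {ι : Type}

theorem annihilate_apply (m : ι) (f : FockSpace ι) (S : Finset ι) :
    annihilate m f S = if m ∈ S then 0 else jwSign m S * f (insert m S) := rfl

theorem occVec_apply (S T : Finset ι) : occVec S T = if T = S then 1 else 0 := by
  rw [occVec, lp.single_apply, Pi.single_apply]

theorem inner_occVec_left (S : Finset ι) (f : FockSpace ι) : ⟪occVec S, f⟫_ℂ = f S := by
  rw [occVec, lp.inner_single_left]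
  simp

theorem conj_jwSign (m : ι) (S : Finset ι) : (starRingEnd ℂ) (jwSign m S) = jwSign m S := by
  simp [jwSign]

theorem jwSign_mul_self (m : ι) (S : Finset ι) : jwSign m S * jwSign m S = 1 := by
  rw [jwSign, ← mul_pow]
  simp

theorem jwSign_insert_of_rel {m n : ι} {S : Finset ι} (hn : n ∉ S) (h : WellOrderingRel n m) :
    jwSign m (insert n S) = -jwSign m S := by
  rw [jwSign, jwSign, Finset.filter_insert, if_pos h, Finset.card_insert_of_notMem (by simp [hn]),
    pow_succ]
  ring

theorem jwSign_insert_of_not_rel {m n : ι} {S : Finset ι} (h : ¬ WellOrderingRel n m) :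
    jwSign m (insert n S) = jwSign m S := by
  rw [jwSign, jwSign, Finset.filter_insert, if_neg h]

/-- Exactly one of m, n precedes the other, so inserting both in either order flips exactly one
sign. This is the source of every minus sign in the anticommutators. -/
theorem jwSign_mul_insert {m n : ι} {S : Finset ι} (hmn : m ≠ n) (hm : m ∉ S) (hn : n ∉ S) :
    jwSign m S * jwSign n (insert m S) = -(jwSign n S * jwSign m (insert n S)) := by
  rcases trichotomous_of WellOrderingRel m n with h | h | h
  · rw [jwSign_insert_of_rel hm h, jwSign_insert_of_not_rel (asymm_of WellOrderingRel h)]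
    ring
  · exact absurd h hmn
  · rw [jwSign_insert_of_rel hn h, jwSign_insert_of_not_rel (asymm_of WellOrderingRel h)]
    ring

theorem annihilate_occVec (m : ι) (S : Finset ι) :
    annihilate m (occVec S) =
      if m ∈ S then jwSign m (S.erase m) • occVec (S.erase m) else 0 := by
  ext T
  rw [annihilate_apply, occVec_apply]
  by_cases hS : m ∈ S
  · rw [if_pos hS, lp.coeFn_smul, Pi.smul_apply, occVec_apply, smul_eq_mul]
    by_cases hT : m ∈ T
    · have : T ≠ S.erase m := fun h => by simp [h] at hT
      simp [hT, this]
    · by_cases h : T = S.erase m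
      · subst h
        simp [Finset.insert_erase hS]
      · have : insert m T ≠ S := fun h' => h (by rw [← h', Finset.erase_insert hT])
        simp [h, this]
  · have : insert m T ≠ S := fun h' => hS (by simp [← h'])
    simp [hS, this]

theorem create_apply (m : ι) (f : FockSpace ι) (S : Finset ι) :
    adjoint (annihilate m) f S =
      if m ∈ S then jwSign m (S.erase m) * f (S.erase m) else 0 := by
  rw [← inner_occVec_left, adjoint_inner_right, annihilate_occVec]
  split_ifs
  · rw [inner_smul_left, inner_occVec_left, conj_jwSign]
  · rw [inner_zero_left]

theorem create_occVec (m : ι) (S : Finset ι) :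
    adjoint (annihilate m) (occVec S) =
      if m ∈ S then 0 else jwSign m S • occVec (insert m S) := by
  ext T
  rw [create_apply, occVec_apply]
  by_cases hS : m ∈ S
  · have : T.erase m ≠ S := fun h' => by simp [← h'] at hS
    simp [hS, this]
  · rw [if_neg hS, lp.coeFn_smul, Pi.smul_apply, occVec_apply, smul_eq_mul]
    by_cases hT : m ∈ T
    · by_cases h : T = insert m S
      · subst h
        simp [Finset.erase_insert hS]
      · have : T.erase m ≠ S := fun h' => h (by rw [← h', Finset.insert_erase hT])
        simp [h, this]
    · have : T ≠ insert m S := fun h' => hT (by simp [h'])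
      simp [hT, this]

theorem annihilate_anticomm (x y : ι) :
    annihilate x * annihilate y + annihilate y * annihilate x = 0 := by
  ext f S
  change annihilate x (annihilate y f) S + annihilate y (annihilate x f) S = 0
  simp only [annihilate_apply, Finset.mem_insert]
  by_cases hxy : x = y
  · subst hxy
    simp
  by_cases hx : x ∈ S
  · simp [hx]
  by_cases hy : y ∈ S
  · simp [hy]
  have h := jwSign_mul_insert hxy hx hy
  simp only [hx, hy, hxy, Ne.symm hxy, or_self, if_false]
  rw [Finset.insert_comm y x, ← mul_assoc, ← mul_assoc, h]
  ring

theorem annihilate_create_anticomm (x y : ι) :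
    annihilate x * adjoint (annihilate y) + adjoint (annihilate y) * annihilate x =
      if x = y then 1 else 0 := by
  ext f S
  by_cases hxy : x = y
  · subst hxy
    rw [if_pos rfl]
    change annihilate x (adjoint (annihilate x) f) S + adjoint (annihilate x) (annihilate x f) S
      = f S
    simp only [annihilate_apply, create_apply]
    by_cases hx : x ∈ S
    · simp [hx, ← mul_assoc, jwSign_mul_self, Finset.insert_erase]
    · simp [hx, ← mul_assoc, jwSign_mul_self]
  · rw [if_neg hxy]
    change annihilate x (adjoint (annihilate y) f) S + adjoint (annihilate y) (annihilate x f) S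
      = 0
    simp only [annihilate_apply, create_apply, Finset.mem_insert, Finset.mem_erase]
    by_cases hx : x ∈ S
    · simp [hx, hxy]
    by_cases hy : y ∈ S
    · obtain ⟨T, hT, rfl⟩ : ∃ T, y ∉ T ∧ S = insert y T :=
        ⟨S.erase y, by simp, (Finset.insert_erase hy).symm⟩
      have hx' : x ∉ T := fun h => hx (by simp [h])
      have h := jwSign_mul_insert hxy hx' hT
      rw [Finset.insert_comm x y]
      have h1 : y ∉ insert x T := by simp [hT, Ne.symm hxy]
      simp only [Finset.erase_insert hT, Finset.erase_insert h1, hx, Finset.mem_insert,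
        true_or, or_true, if_true, if_false, and_false]
      have h2 := jwSign_mul_self x T
      have h3 := jwSign_mul_self y T
      -- Since each sign squares to one, the exchange rule `h` can be multiplied through to move
      -- factors between its two sides.
      have h4 : jwSign x (insert y T) * jwSign y (insert x T) = -(jwSign y T * jwSign x T) := by
        linear_combination (jwSign x T * jwSign x (insert y T)) * h
          - (jwSign x (insert y T) * jwSign y (insert x T)) * h2
          - jwSign y T * jwSign x T * jwSign_mul_self x (insert y T)
      linear_combination f (insert x T) * h4
    · simp [hx, hy, Ne.symm hxy]

/-- The span of the occupation-number basis. -/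
abbrev finiteVectors (ι : Type) : Submodule ℂ (FockSpace ι) :=
  Submodule.span ℂ (Set.range occVec)

theorem occVec_mem_finiteVectors (S : Finset ι) : occVec S ∈ finiteVectors ι :=
  Submodule.subset_span ⟨S, rfl⟩

theorem hasSum_occVec (f : FockSpace ι) : HasSum (fun S => f S • occVec S) f := by
  convert lp.hasSum_single ENNReal.ofNat_ne_top f using 2 with S
  rw [occVec, ← lp.single_smul, smul_eq_mul, mul_one]

theorem dense_finiteVectors : Dense (finiteVectors ι : Set (FockSpace ι)) := fun f =>
  mem_closure_of_tendsto (hasSum_occVec f) (Filter.Eventually.of_forall fun _ =>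
    Submodule.sum_mem _ fun S _ => Submodule.smul_mem _ _ (occVec_mem_finiteVectors S))

theorem mem_finiteVectors_of_forall_occVec {A : FockSpace ι →ₗ[ℂ] FockSpace ι}
    (hA : ∀ S, A (occVec S) ∈ finiteVectors ι) {φ : FockSpace ι} (hφ : φ ∈ finiteVectors ι) :
    A φ ∈ finiteVectors ι := by
  induction hφ using Submodule.span_induction with
  | mem x h => obtain ⟨S, rfl⟩ := h; exact hA S
  | zero => simp
  | add x y _ _ hx hy => rw [map_add]; exact Submodule.add_mem _ hx hy
  | smul c x _ hx => rw [map_smul]; exact Submodule.smul_mem _ _ hx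

theorem annihilate_mem_finiteVectors (m : ι) {φ : FockSpace ι} (hφ : φ ∈ finiteVectors ι) :
    annihilate m φ ∈ finiteVectors ι := by
  refine mem_finiteVectors_of_forall_occVec (A := (annihilate m).toLinearMap) (fun S => ?_) hφ
  rw [coe_coe, annihilate_occVec]
  split_ifs
  · exact Submodule.smul_mem _ _ (occVec_mem_finiteVectors _)
  · exact Submodule.zero_mem _

theorem create_mem_finiteVectors (m : ι) {φ : FockSpace ι} (hφ : φ ∈ finiteVectors ι) :
    adjoint (annihilate m) φ ∈ finiteVectors ι := by
  refine mem_finiteVectors_of_forall_occVec (A := (adjoint (annihilate m)).toLinearMap)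
    (fun S => ?_) hφ
  rw [coe_coe, create_occVec]
  split_ifs
  · exact Submodule.zero_mem _
  · exact Submodule.smul_mem _ _ (occVec_mem_finiteVectors _)

end Fock

/-! ### Normal-ordered bilinears, finiteness on finite vectors, and the Schwinger term. -/

section Bilinears

open Classical ContinuousLinearMap

variable {X : Type}

/-- The fermion field for a signed one-particle energy `e`: it annihilates a particle if `0 < e x`
and creates a hole otherwise. -/
def fieldOp (e : X → ℝ) (x : X) : FockSpace X →L[ℂ] FockSpace X :=
  if 0 < e x then annihilate x else adjoint (annihilate x)

/-- Occupation number of the state `x` in the Dirac sea. -/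
def seaOcc (e : X → ℝ) (x : X) : ℂ := if 0 < e x then 0 else 1

/-- The normal-ordered bilinear `:b†(x) b(y):`. -/
def normalBilinear (e : X → ℝ) (x y : X) : FockSpace X →L[ℂ] FockSpace X :=
  star (fieldOp e x) * fieldOp e y - (if x = y then seaOcc e x else 0) • 1

theorem create_anticomm (x y : X) :
    adjoint (annihilate x) * adjoint (annihilate y) +
      adjoint (annihilate y) * adjoint (annihilate x) = 0 := by
  have h := congrArg star (annihilate_anticomm y x)
  simpa only [star_add, star_mul, star_zero, star_eq_adjoint] using h

theorem fieldOp_anticomm (e : X → ℝ) (x y : X) :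
    fieldOp e x * fieldOp e y + fieldOp e y * fieldOp e x = 0 := by
  unfold fieldOp
  by_cases hx : 0 < e x <;> by_cases hy : 0 < e y
  · simp only [hx, hy, if_true, annihilate_anticomm]
  · have : x ≠ y := fun h => hy (h ▸ hx)
    simp only [hx, hy, if_true, if_false, annihilate_create_anticomm, this]
  · have : y ≠ x := fun h => hx (h ▸ hy)
    rw [add_comm]
    simp only [hx, hy, if_true, if_false, annihilate_create_anticomm, this]
  · simp only [hx, hy, if_false, create_anticomm]

theorem star_fieldOp_anticomm (e : X → ℝ) (x y : X) :
    star (fieldOp e x) * star (fieldOp e y) + star (fieldOp e y) * star (fieldOp e x) = 0 := by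
  have h := congrArg star (fieldOp_anticomm e y x)
  simpa only [star_add, star_mul, star_zero] using h

theorem fieldOp_star_anticomm (e : X → ℝ) (x y : X) :
    fieldOp e x * star (fieldOp e y) + star (fieldOp e y) * fieldOp e x =
      if x = y then 1 else 0 := by
  unfold fieldOp
  by_cases hx : 0 < e x <;> by_cases hy : 0 < e y
  · simp only [hx, hy, if_true, star_eq_adjoint, annihilate_create_anticomm]
  · have : x ≠ y := fun h => hy (h ▸ hx)
    simp only [hx, hy, this, if_true, if_false, star_eq_adjoint, adjoint_adjoint,
      annihilate_anticomm]
  · have : x ≠ y := fun h => hx (h ▸ hy)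
    simp only [hx, hy, this, if_true, if_false, star_eq_adjoint, create_anticomm]
  · rw [add_comm]
    simp only [hx, hy, if_false, star_eq_adjoint, adjoint_adjoint, annihilate_create_anticomm,
      eq_comm]

theorem seaOcc_conj (e : X → ℝ) (x : X) : star (seaOcc e x) = seaOcc e x := by
  unfold seaOcc; split_ifs <;> simp

theorem star_normalBilinear (e : X → ℝ) (x y : X) :
    star (normalBilinear e x y) = normalBilinear e y x := by
  unfold normalBilinear
  rw [star_sub, star_mul, star_star, star_smul, star_one]
  by_cases h : x = y
  · subst h; simp [seaOcc_conj]
  · simp [h, Ne.symm h]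

/-- Without normal ordering these are the commutators of matrix units. The vacuum constants drop out
of the commutator on the left, but must be put back when the right side is rewritten in
normal-ordered form; their difference is the scalar term. -/
theorem normalBilinear_comm (e : X → ℝ) (x y z w : X) :
    normalBilinear e x y * normalBilinear e z w - normalBilinear e z w * normalBilinear e x y =
      (if y = z then normalBilinear e x w else 0) - (if x = w then normalBilinear e z y else 0) +
        (if y = z ∧ x = w then seaOcc e x - seaOcc e z else 0) • 1 := by
  have key : ∀ A B C D : FockSpace X →L[ℂ] FockSpace X, ∀ s t : FockSpace X →L[ℂ] FockSpace X,
      B * C + C * B = s → D * A + A * D = t → A * C + C * A = 0 → B * D + D * B = 0 →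
      A * B * (C * D) - C * D * (A * B) = A * s * D - C * t * B := by
    intro A B C D s t h1 h2 h3 h4
    subst h1 h2
    have h3' : A * C = - (C * A) := eq_neg_of_add_eq_zero_left h3
    have h4' : B * D = - (D * B) := eq_neg_of_add_eq_zero_left h4
    have : A * C * (B * D) = C * A * (D * B) := by rw [h3', h4', neg_mul_neg]
    calc A * B * (C * D) - C * D * (A * B)
        = A * (B * C + C * B) * D - C * (D * A + A * D) * B
          - (A * C * (B * D) - C * A * (D * B)) := by noncomm_ring
      _ = _ := by rw [this, sub_self, sub_zero]
  have h := key (star (fieldOp e x)) (fieldOp e y) (star (fieldOp e z)) (fieldOp e w) _ _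
    (fieldOp_star_anticomm e y z) (fieldOp_star_anticomm e w x) (star_fieldOp_anticomm e x z)
    (fieldOp_anticomm e y w)
  have hc : ∀ (P Q : FockSpace X →L[ℂ] FockSpace X) (a b : ℂ),
      (P - a • 1) * (Q - b • 1) - (Q - b • 1) * (P - a • 1) = P * Q - Q * P := by
    intro P Q a b
    simp only [sub_mul, mul_sub, smul_mul_assoc, mul_smul_comm, one_mul, mul_one, smul_sub]
    rw [smul_comm a b]
    abel
  unfold normalBilinear
  rw [hc, h]
  by_cases hyz : y = z <;> by_cases hxw : x = w
  · subst hyz hxw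
    simp only [if_true, and_self, mul_one, sub_smul]
    abel
  · subst hyz
    simp [hxw, Ne.symm hxw]
  · subst hxw
    simp [hyz, Ne.symm hyz]
  · simp [hyz, hxw, Ne.symm hxw]

theorem fieldOp_mem_finiteVectors (e : X → ℝ) (x : X) {φ : FockSpace X}
    (hφ : φ ∈ finiteVectors X) : fieldOp e x φ ∈ finiteVectors X := by
  unfold fieldOp
  split_ifs
  · exact annihilate_mem_finiteVectors x hφ
  · exact create_mem_finiteVectors x hφ

theorem star_fieldOp_mem_finiteVectors (e : X → ℝ) (x : X) {φ : FockSpace X}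
    (hφ : φ ∈ finiteVectors X) : star (fieldOp e x) φ ∈ finiteVectors X := by
  unfold fieldOp
  split_ifs
  · exact create_mem_finiteVectors x hφ
  · rw [star_eq_adjoint, adjoint_adjoint]
    exact annihilate_mem_finiteVectors x hφ

theorem normalBilinear_mem_finiteVectors (e : X → ℝ) (x y : X) {φ : FockSpace X}
    (hφ : φ ∈ finiteVectors X) : normalBilinear e x y φ ∈ finiteVectors X :=
  Submodule.sub_mem _ (star_fieldOp_mem_finiteVectors e x (fieldOp_mem_finiteVectors e y hφ))
    (Submodule.smul_mem _ _ hφ)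

/-- For a hole state b†(x) is itself an annihilator. Anticommuting it to the right produces
precisely the contraction that normal ordering subtracts. -/
theorem normalBilinear_eq_of_hole {e : X → ℝ} {x : X} (hx : ¬ 0 < e x) (y : X) :
    normalBilinear e x y = -(fieldOp e y * annihilate x) := by
  have h := fieldOp_star_anticomm e y x
  have hs : star (fieldOp e x) = annihilate x := by
    rw [fieldOp, if_neg hx, star_eq_adjoint, adjoint_adjoint]
  rw [hs] at h
  rw [normalBilinear, hs, seaOcc, if_neg hx]
  by_cases hxy : x = y
  · subst hxy
    simp only [if_true, one_smul] at h ⊢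
    rw [← h]
    abel
  · rw [if_neg (Ne.symm hxy)] at h
    rw [if_neg hxy, zero_smul, sub_zero]
    exact eq_neg_of_add_eq_zero_right h

theorem normalBilinear_eq_of_particle {e : X → ℝ} {x y : X} (hx : 0 < e x) (hy : 0 < e y) :
    normalBilinear e x y = adjoint (annihilate x) * annihilate y := by
  simp [normalBilinear, seaOcc, fieldOp, hx, hy, star_eq_adjoint]

/-- A bilinear that does not annihilate a basis vector either annihilates one of its excitations
or creates a particle-hole pair. -/
theorem normalBilinear_occVec_eq_zero {e : X → ℝ} {x y : X} {S : Finset X} (hx : x ∉ S)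
    (hy : y ∉ S) (h : ¬ (e y ≤ 0 ∧ 0 < e x)) : normalBilinear e x y (occVec S) = 0 := by
  by_cases hex : 0 < e x
  · have hey : 0 < e y := not_le.mp fun h' => h ⟨h', hex⟩
    rw [normalBilinear_eq_of_particle hex hey]
    change adjoint (annihilate x) (annihilate y (occVec S)) = 0
    rw [annihilate_occVec, if_neg hy, map_zero]
  · rw [normalBilinear_eq_of_hole hex]
    change -(fieldOp e y (annihilate x (occVec S))) = 0
    rw [annihilate_occVec, if_neg hx, map_zero, neg_zero]

/-- On a basis vector a surviving term either touches an occupied mode, which bounds one energy and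
hence the other through c, or creates a pair, whose two energies straddle zero at distance c. -/
theorem exists_bound_of_normalBilinear_ne_zero (e : X → ℝ) (c : ℝ) {φ : FockSpace X}
    (hφ : φ ∈ finiteVectors X) :
    ∃ R : ℝ, ∀ x y, e x = e y + c → normalBilinear e x y φ ≠ 0 → |e x| ≤ R ∧ |e y| ≤ R := by
  induction hφ using Submodule.span_induction with
  | mem φ h =>
    obtain ⟨S, rfl⟩ := h
    refine ⟨∑ z ∈ S, |e z| + |c|, fun x y hxy hne => ?_⟩
    have hS : ∀ z ∈ S, |e z| ≤ ∑ z ∈ S, |e z| := fun z hz =>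
      Finset.single_le_sum (f := fun z => |e z|) (fun _ _ => abs_nonneg _) hz
    have h0 : 0 ≤ ∑ z ∈ S, |e z| := Finset.sum_nonneg fun _ _ => abs_nonneg _
    have hc := abs_le.mp (le_refl |c|)
    by_cases hx : x ∈ S
    · have := abs_le.mp (hS x hx)
      constructor <;> rw [abs_le] <;> constructor <;> linarith
    by_cases hy : y ∈ S
    · have := abs_le.mp (hS y hy)
      constructor <;> rw [abs_le] <;> constructor <;> linarith
    by_cases h : e y ≤ 0 ∧ 0 < e x
    · constructor <;> rw [abs_le] <;> constructor <;> linarith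
    · exact absurd (normalBilinear_occVec_eq_zero hx hy h) hne
  | zero => exact ⟨0, fun x y _ h => absurd (map_zero _) h⟩
  | add φ ψ _ _ h₁ h₂ =>
    obtain ⟨R₁, h₁⟩ := h₁
    obtain ⟨R₂, h₂⟩ := h₂
    refine ⟨max R₁ R₂, fun x y hxy hne => ?_⟩
    by_cases h : normalBilinear e x y φ = 0
    · have := h₂ x y hxy fun h' => hne (by rw [map_add, h, h', add_zero])
      exact ⟨this.1.trans (le_max_right _ _), this.2.trans (le_max_right _ _)⟩
    · have := h₁ x y hxy h
      exact ⟨this.1.trans (le_max_left _ _), this.2.trans (le_max_left _ _)⟩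
  | smul a φ _ h =>
    obtain ⟨R, h⟩ := h
    exact ⟨R, fun x y hxy hne => h x y hxy fun h' => hne (by rw [map_smul, h', smul_zero])⟩

/-- The matrix `U` changes the one-particle energy by exactly `c`. -/
def ShiftsBy (e : X → ℝ) (c : ℝ) (U : X → X → ℂ) : Prop :=
  ∀ x y, U x y ≠ 0 → e x = e y + c

/-- The second quantization `∑ U(x, y) :b†(x) b(y):` applied to a vector. -/
def secondQuant (e : X → ℝ) (U : X → X → ℂ) (φ : FockSpace X) : FockSpace X :=
  ∑' p : X × X, U p.1 p.2 • normalBilinear e p.1 p.2 φ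

variable {e : X → ℝ} (he : ∀ E : ℝ, {x | |e x| ≤ E}.Finite)

include he in
theorem hasSum_secondQuant {c : ℝ} {U : X → X → ℂ} (hU : ShiftsBy e c U) {φ : FockSpace X}
    (hφ : φ ∈ finiteVectors X) :
    ∃ R₀ : ℝ, ∀ R, R₀ ≤ R → HasSum (fun p : X × X => U p.1 p.2 • normalBilinear e p.1 p.2 φ)
      (∑ p ∈ (he R).toFinset ×ˢ (he R).toFinset, U p.1 p.2 • normalBilinear e p.1 p.2 φ) := by
  obtain ⟨R₀, hR⟩ := exists_bound_of_normalBilinear_ne_zero e c hφ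
  refine ⟨R₀, fun R hRR => hasSum_sum_of_ne_finset_zero fun p hp => ?_⟩
  by_contra hne
  have h1 : U p.1 p.2 ≠ 0 := fun h => hne (by rw [h, zero_smul])
  have h2 : normalBilinear e p.1 p.2 φ ≠ 0 := fun h => hne (by rw [h, smul_zero])
  have h3 := hR p.1 p.2 (hU _ _ h1) h2
  refine hp ?_
  simp only [Finset.mem_product, Set.Finite.mem_toFinset, Set.mem_ofPred_eq]
  exact ⟨h3.1.trans hRR, h3.2.trans hRR⟩

include he in
theorem summable_secondQuant {c : ℝ} {U : X → X → ℂ} (hU : ShiftsBy e c U) {φ : FockSpace X}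
    (hφ : φ ∈ finiteVectors X) :
    Summable (fun p : X × X => U p.1 p.2 • normalBilinear e p.1 p.2 φ) := by
  obtain ⟨R, hR⟩ := hasSum_secondQuant he hU hφ
  exact (hR R le_rfl).summable

include he in
theorem secondQuant_eq_sum {c : ℝ} {U : X → X → ℂ} (hU : ShiftsBy e c U) {φ : FockSpace X}
    (hφ : φ ∈ finiteVectors X) :
    ∃ R₀ : ℝ, ∀ R, R₀ ≤ R → secondQuant e U φ =
      ∑ p ∈ (he R).toFinset ×ˢ (he R).toFinset, U p.1 p.2 • normalBilinear e p.1 p.2 φ := by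
  obtain ⟨R, hR⟩ := hasSum_secondQuant he hU hφ
  exact ⟨R, fun R' h => (hR R' h).tsum_eq⟩

include he in
theorem secondQuant_mem_finiteVectors {c : ℝ} {U : X → X → ℂ} (hU : ShiftsBy e c U)
    {φ : FockSpace X} (hφ : φ ∈ finiteVectors X) : secondQuant e U φ ∈ finiteVectors X := by
  obtain ⟨R, hR⟩ := secondQuant_eq_sum he hU hφ
  rw [hR R le_rfl]
  exact Submodule.sum_mem _ fun p _ =>
    Submodule.smul_mem _ _ (normalBilinear_mem_finiteVectors e _ _ hφ)

theorem ShiftsBy.of_hasSum {c c' : ℝ} {U V W : X → X → ℂ} (hU : ShiftsBy e c U)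
    (hV : ShiftsBy e c' V) (hW : ∀ x w, HasSum (fun y => U x y * V y w) (W x w)) :
    ShiftsBy e (c + c') W := by
  intro x w hne
  by_contra h
  refine hne ((hW x w).unique ?_)
  convert hasSum_zero with y
  by_contra hy
  have h1 := hU x y (left_ne_zero_of_mul hy)
  have h2 := hV y w (right_ne_zero_of_mul hy)
  exact h (by linarith)

include he in
theorem secondQuant_product_eq_sum {c c' : ℝ} {U V W : X → X → ℂ} (hU : ShiftsBy e c U)
    (hV : ShiftsBy e c' V) (hW : ∀ x w, HasSum (fun y => U x y * V y w) (W x w))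
    {φ : FockSpace X} (hφ : φ ∈ finiteVectors X) :
    ∃ R₀ : ℝ, ∀ R, R₀ ≤ R → secondQuant e W φ =
      ∑ x ∈ (he R).toFinset, ∑ w ∈ (he R).toFinset,
        (∑ y ∈ (he R).toFinset, U x y * V y w) • normalBilinear e x w φ := by
  have hWs := hU.of_hasSum hV hW
  obtain ⟨R₁, h₁⟩ := secondQuant_eq_sum he hWs hφ
  obtain ⟨R₂, h₂⟩ := exists_bound_of_normalBilinear_ne_zero e (c + c') hφ
  -- The margin |c'| makes the cutoff sum over the intermediate mode y complete, because its energy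
  -- is that of w shifted by c'.
  refine ⟨max R₁ (R₂ + |c'|), fun R hR => ?_⟩
  rw [h₁ R ((le_max_left _ _).trans hR), Finset.sum_product]
  refine Finset.sum_congr rfl fun x _ => Finset.sum_congr rfl fun w _ => ?_
  by_cases hN : normalBilinear e x w φ = 0
  · rw [hN, smul_zero, smul_zero]
  congr 1
  refine (hW x w).unique (hasSum_sum_of_ne_finset_zero fun y hy => ?_)
  by_contra hne
  have h3 := hU x y (left_ne_zero_of_mul hne)
  have h4 := hV y w (right_ne_zero_of_mul hne)
  refine hy ?_
  rw [Set.Finite.mem_toFinset, Set.mem_ofPred_eq, h4]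
  have h5 := (h₂ x w (by linarith) hN).2
  exact (abs_add_le _ _).trans ((by linarith : |e w| + |c'| ≤ R₂ + |c'|).trans
    ((le_max_right _ _).trans hR))

/-- The occupations differ only if the two energies lie on opposite sides of zero; being c apart,
both are then at most |c| in absolute value. -/
theorem schwinger_eq_sum {c : ℝ} {U V : X → X → ℂ} (hU : ShiftsBy e c U) {κ : ℂ}
    (hκ : HasSum (fun p : X × X => U p.1 p.2 * V p.2 p.1 * (seaOcc e p.1 - seaOcc e p.2)) κ)
    {R : ℝ} (hR : |c| ≤ R) :
    κ = ∑ x ∈ (he R).toFinset, ∑ y ∈ (he R).toFinset,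
      U x y * V y x * (seaOcc e x - seaOcc e y) := by
  rw [← Finset.sum_product']
  refine hκ.unique (hasSum_sum_of_ne_finset_zero fun p hp => ?_)
  by_contra hne
  have h1 := hU _ _ (left_ne_zero_of_mul (left_ne_zero_of_mul hne))
  have h2 := right_ne_zero_of_mul hne
  refine hp ?_
  simp only [Finset.mem_product, Set.Finite.mem_toFinset, Set.mem_ofPred_eq]
  have hc := abs_le.mp (le_refl |c|)
  unfold seaOcc at h2
  constructor <;> rw [abs_le] <;> constructor <;>
    · by_cases hx : 0 < e p.1 <;> by_cases hy : 0 < e p.2 <;> simp [hx, hy] at h2 <;> linarith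

theorem sum_comm_pairs {M : Type*} [AddCommMonoid M] (G : Finset X) (f : X → X → X → X → M) :
    ∑ x ∈ G, ∑ y ∈ G, ∑ z ∈ G, ∑ w ∈ G, f x y z w =
      ∑ z ∈ G, ∑ w ∈ G, ∑ x ∈ G, ∑ y ∈ G, f x y z w := by
  simpa only [Finset.sum_product] using Finset.sum_comm (s := G ×ˢ G) (t := G ×ˢ G)
    (f := fun p q => f p.1 p.2 q.1 q.2)

theorem sum_ite_eq_middle {M : Type*} [AddCommMonoid M] (G : Finset X)
    (f : X → X → X → X → M) :
    ∑ x ∈ G, ∑ y ∈ G, ∑ z ∈ G, ∑ w ∈ G, (if y = z then f x y z w else 0) =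
      ∑ x ∈ G, ∑ w ∈ G, ∑ y ∈ G, f x y y w := by
  refine Finset.sum_congr rfl fun x _ => ?_
  rw [Finset.sum_comm (s := G) (t := G) (f := fun w y => f x y y w)]
  refine Finset.sum_congr rfl fun y hy => ?_
  rw [Finset.sum_comm]
  refine Finset.sum_congr rfl fun w _ => ?_
  rw [Finset.sum_ite_eq, if_pos hy]

theorem sum_ite_eq_outer {M : Type*} [AddCommMonoid M] (G : Finset X)
    (f : X → X → X → X → M) :
    ∑ x ∈ G, ∑ y ∈ G, ∑ z ∈ G, ∑ w ∈ G, (if x = w then f z w x y else 0) =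
      ∑ z ∈ G, ∑ y ∈ G, ∑ w ∈ G, f z w w y := by
  rw [sum_comm_pairs, ← sum_ite_eq_middle]
  exact Finset.sum_congr rfl fun z _ => Finset.sum_congr rfl fun w _ => Finset.sum_congr rfl
    fun x _ => Finset.sum_congr rfl fun y _ => if_congr eq_comm rfl rfl

include he in
/-- The commutator of two second-quantized operators, with its Schwinger term. -/
theorem secondQuant_comm {c c' : ℝ} {U V W W' : X → X → ℂ} {κ : ℂ} (hU : ShiftsBy e c U)
    (hV : ShiftsBy e c' V) (hW : ∀ x w, HasSum (fun y => U x y * V y w) (W x w))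
    (hW' : ∀ x w, HasSum (fun y => V x y * U y w) (W' x w))
    (hκ : HasSum (fun p : X × X => U p.1 p.2 * V p.2 p.1 * (seaOcc e p.1 - seaOcc e p.2)) κ)
    {φ : FockSpace X} (hφ : φ ∈ finiteVectors X) :
    secondQuant e U (secondQuant e V φ) - secondQuant e V (secondQuant e U φ) =
      secondQuant e W φ - secondQuant e W' φ + κ • φ := by
  obtain ⟨R₁, h₁⟩ := secondQuant_eq_sum he hU hφ
  obtain ⟨R₂, h₂⟩ := secondQuant_eq_sum he hV hφ
  obtain ⟨R₃, h₃⟩ := secondQuant_eq_sum he hU (secondQuant_mem_finiteVectors he hV hφ)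
  obtain ⟨R₄, h₄⟩ := secondQuant_eq_sum he hV (secondQuant_mem_finiteVectors he hU hφ)
  obtain ⟨R₅, h₅⟩ := secondQuant_product_eq_sum he hU hV hW hφ
  obtain ⟨R₆, h₆⟩ := secondQuant_product_eq_sum he hV hU hW' hφ
  -- One cutoff serves all sums, including those applied to the images of φ, so that the identity
  -- becomes one of finite sums over the same set of modes.
  obtain ⟨R, hR⟩ : ∃ R : ℝ, ∀ r ∈ ({R₁, R₂, R₃, R₄, R₅, R₆, |c|} : Finset ℝ), r ≤ R :=
    Finset.exists_le _
  simp only [Finset.mem_insert, Finset.mem_singleton, forall_eq_or_imp, forall_eq] at hR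
  obtain ⟨r₁, r₂, r₃, r₄, r₅, r₆, r₇⟩ := hR
  rw [h₃ R r₃, h₄ R r₄, h₁ R r₁, h₂ R r₂, h₅ R r₅, h₆ R r₆, schwinger_eq_sum he hU hκ r₇]
  set G := (he R).toFinset
  simp only [map_sum, map_smul, Finset.smul_sum, smul_smul]
  rw [Finset.sum_comm (s := G ×ˢ G) (t := G ×ˢ G)
    (f := fun q p => (V q.1 q.2 * U p.1 p.2) •
      normalBilinear e q.1 q.2 (normalBilinear e p.1 p.2 φ)), ← Finset.sum_sub_distrib]
  have hterm : ∀ p q : X × X,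
      (U p.1 p.2 * V q.1 q.2) • normalBilinear e p.1 p.2 (normalBilinear e q.1 q.2 φ) -
        (V q.1 q.2 * U p.1 p.2) • normalBilinear e q.1 q.2 (normalBilinear e p.1 p.2 φ) =
      (if p.2 = q.1 then (U p.1 p.2 * V q.1 q.2) • normalBilinear e p.1 q.2 φ else 0) -
      (if p.1 = q.2 then (V q.1 q.2 * U p.1 p.2) • normalBilinear e q.1 p.2 φ else 0) +
      (if p.2 = q.1 then if p.1 = q.2 then
        (U p.1 p.2 * V q.1 q.2 * (seaOcc e p.1 - seaOcc e q.1)) • φ else 0 else 0) := by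
    intro p q
    have h : normalBilinear e p.1 p.2 (normalBilinear e q.1 q.2 φ) -
        normalBilinear e q.1 q.2 (normalBilinear e p.1 p.2 φ) = _ :=
      DFunLike.congr_fun (normalBilinear_comm e p.1 p.2 q.1 q.2) φ
    rw [mul_comm (V q.1 q.2), ← smul_sub, h, add_apply, sub_apply, smul_apply, one_apply_eq_self]
    by_cases h1 : p.2 = q.1 <;> by_cases h2 : p.1 = q.2 <;>
      simp [h1, h2, smul_sub, smul_add, smul_smul]
  simp only [← Finset.sum_sub_distrib, hterm, Finset.sum_add_distrib]
  simp only [Finset.sum_sub_distrib, Finset.sum_product]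
  congr 1
  · simp only [Finset.sum_smul]
    congr 1
    · exact sum_ite_eq_middle G fun x y z w => (U x y * V z w) • normalBilinear e x w φ
    · exact sum_ite_eq_outer G fun z w x y => (V z w * U x y) • normalBilinear e z y φ
  -- In the scalar part the two contractions force z = y and w = x, leaving a double sum.
  · simp only [Finset.sum_smul]
    refine Finset.sum_congr rfl fun x hx => Finset.sum_congr rfl fun y hy => ?_
    rw [Finset.sum_eq_single_of_mem y hy, Finset.sum_eq_single_of_mem x hx]
    · simp
    · intro w _ hw
      simp [Ne.symm hw]
    · intro z _ hz
      simp [Ne.symm hz]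

end Bilinears

/-! ### Unbounded operators: closures and adjoints from a grading with finite fibers. -/

section Closure

open ContinuousLinearMap

theorem LinearPMap.closure_le_of_isClosed {E : Type*} [NormedAddCommGroup E] [NormedSpace ℂ E]
    {f g : E →ₗ.[ℂ] E} (hfg : f ≤ g) (hg : g.IsClosed) : f.closure ≤ g := by
  have hf := hg.isClosable.leIsClosable hfg
  rw [← LinearPMap.le_graph_iff, ← hf.graph_closure_eq_closure_graph]
  exact Submodule.topologicalClosure_minimal _ (LinearPMap.le_graph_iff.mpr hfg) hg

theorem LinearPMap.adjoint_antitone {E : Type*} [NormedAddCommGroup E] [InnerProductSpace ℂ E]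
    [CompleteSpace E] {f g : E →ₗ.[ℂ] E} (hf : Dense (f.domain : Set E)) (hfg : f ≤ g) :
    g.adjoint ≤ f.adjoint := by
  refine LinearPMap.IsFormalAdjoint.le_adjoint hf fun x y => ?_
  have h := LinearPMap.adjoint_isFormalAdjoint (hf.mono hfg.1) y ⟨x, hfg.1 x.2⟩
  rw [hfg.2 (x := x) (y := ⟨x, hfg.1 x.2⟩) rfl, ← inner_conj_symm, ← h, inner_conj_symm]

theorem LinearPMap.adjoint_smul {E : Type*} [NormedAddCommGroup E] [InnerProductSpace ℂ E]
    [CompleteSpace E] {f : E →ₗ.[ℂ] E} (hf : Dense (f.domain : Set E)) {c : ℂ} (hc : c ≠ 0) :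
    (c • f).adjoint = (starRingEnd ℂ c) • f.adjoint := by
  have hcf : Dense ((c • f).domain : Set E) := hf
  have hc' : starRingEnd ℂ c ≠ 0 := by simpa using hc
  apply le_antisymm
  · refine ⟨fun y hy => ?_, fun x y hxy => ?_⟩
    · refine LinearPMap.mem_adjoint_domain_of_exists _
        ⟨(starRingEnd ℂ c)⁻¹ • (c • f).adjoint ⟨y, hy⟩, fun x => ?_⟩
      have h : ⟪(c • f).adjoint ⟨y, hy⟩, (x : E)⟫_ℂ = ⟪y, c • f x⟫_ℂ :=
        LinearPMap.adjoint_isFormalAdjoint hcf ⟨y, hy⟩ x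
      rw [inner_smul_left, h, inner_smul_right, map_inv₀, Complex.conj_conj, ← mul_assoc,
        inv_mul_cancel₀ hc, one_mul]
    · refine LinearPMap.adjoint_apply_eq hcf x fun z => ?_
      change ⟪starRingEnd ℂ c • f.adjoint y, (z : E)⟫_ℂ = ⟪(x : E), c • f z⟫_ℂ
      rw [inner_smul_left, inner_smul_right, Complex.conj_conj, hxy,
        LinearPMap.adjoint_isFormalAdjoint hf y z]
  · refine LinearPMap.IsFormalAdjoint.le_adjoint hcf fun x y => ?_
    change ⟪c • f x, (y : E)⟫_ℂ = ⟪(x : E), starRingEnd ℂ c • f.adjoint y⟫_ℂ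
    rw [inner_smul_left, inner_smul_right,
      (LinearPMap.adjoint_isFormalAdjoint hf).symm x y]

/-- Two formally adjoint operators on the finite vectors, which map finite blocks of basis vectors
to blocks by a shift, are adjoint to each other up to closure. -/
theorem adjoint_eq_closure_of_shift {X : Type} {A B : FockSpace X →ₗ.[ℂ] FockSpace X}
    (hA : A.domain = finiteVectors X) (hB : B.domain = finiteVectors X)
    (hAB : A.IsFormalAdjoint B) {blk : Finset X → ℝ} (hfin : ∀ t, (blk ⁻¹' {t}).Finite) (c : ℝ)
    (hblk : ∀ (S T : Finset X) (h : occVec S ∈ B.domain),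
      B ⟨occVec S, h⟩ T ≠ 0 → blk T = blk S + c) :
    B.IsClosable ∧ A.adjoint = B.closure := by
  classical
  have hdense : Dense (A.domain : Set (FockSpace X)) := by rw [hA]; exact dense_finiteVectors
  have hle : B ≤ A.adjoint := LinearPMap.IsFormalAdjoint.le_adjoint hdense hAB
  have hcl : A.adjoint.IsClosed := LinearPMap.adjoint_isClosed hdense
  have hBc : B.IsClosable := hcl.isClosable.leIsClosable hle
  refine ⟨hBc, le_antisymm ?_ (LinearPMap.closure_le_of_isClosed hle hcl)⟩
  rw [← LinearPMap.le_graph_iff, ← hBc.graph_closure_eq_closure_graph]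
  rintro ⟨φ, η⟩ hφη
  obtain ⟨⟨ψ, hψ⟩, rfl, rfl⟩ := (LinearPMap.mem_graph_iff _).mp hφη
  set η := A.adjoint ⟨ψ, hψ⟩
  have hmA : ∀ S, occVec S ∈ A.domain := fun S => hA ▸ occVec_mem_finiteVectors S
  have hmB : ∀ S, occVec S ∈ B.domain := fun S => hB ▸ occVec_mem_finiteVectors S
  -- The matrix entries of `B` determine the adjoint of `A` coordinatewise, even at vectors outside
  -- the domain of `B`.
  have hcoord : ∀ S T, ⟪A ⟨occVec T, hmA T⟩, occVec S⟫_ℂ = B ⟨occVec S, hmB S⟩ T := by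
    intro S T
    rw [← inner_occVec_left]
    exact hAB ⟨occVec T, hmA T⟩ ⟨occVec S, hmB S⟩
  have hη : ∀ T, HasSum (fun S => ψ S * B ⟨occVec S, hmB S⟩ T) (η T) := by
    intro T
    have h := (innerSL ℂ (A ⟨occVec T, hmA T⟩)).hasSum (hasSum_occVec ψ)
    have h2 : ⟪A ⟨occVec T, hmA T⟩, ψ⟫_ℂ = η T := by
      rw [← inner_occVec_left]
      exact (LinearPMap.adjoint_isFormalAdjoint hdense).symm ⟨occVec T, hmA T⟩ ⟨ψ, hψ⟩
    rw [innerSL_apply_apply, h2] at h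
    simpa only [innerSL_apply_apply, inner_smul_right, hcoord] using h
  -- For a finite set F of grades, `hY` selects the source blocks and `hZ` the same blocks shifted
  -- by c. Both exhaust the basis as F grows, so the truncations of ψ and η along them converge.
  have hY : ∀ F : Finset ℝ, (blk ⁻¹' (F : Set ℝ)).Finite := fun F =>
    F.finite_toSet.preimage' fun t _ => hfin t
  have hZ : ∀ F : Finset ℝ, ((fun T => blk T - c) ⁻¹' (F : Set ℝ)).Finite := fun F =>
    F.finite_toSet.preimage' fun t _ => (hfin (t + c)).subset fun T hT => by
      simp only [Set.mem_preimage, Set.mem_singleton_iff] at hT ⊢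
      linarith
  have htY : Filter.Tendsto (fun F => (hY F).toFinset) Filter.atTop Filter.atTop := by
    refine Filter.tendsto_atTop_finset_of_monotone (fun F G h S => ?_) fun S => ⟨{blk S}, by simp⟩
    simpa using fun h' => h h'
  have htZ : Filter.Tendsto (fun F => (hZ F).toFinset) Filter.atTop Filter.atTop := by
    refine Filter.tendsto_atTop_finset_of_monotone (fun F G h S => ?_)
      fun S => ⟨{blk S - c}, by simp⟩
    simpa using fun h' => h h'
  refine mem_closure_of_tendsto (((hasSum_occVec ψ).comp htY).prodMk_nhds
    ((hasSum_occVec η).comp htZ)) (Filter.Eventually.of_forall fun F => ?_)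
  change _ ∈ B.graph
  rw [LinearPMap.mem_graph_iff]
  have hmem : ∑ S ∈ (hY F).toFinset, ψ S • occVec S ∈ B.domain :=
    Submodule.sum_mem _ fun S _ => Submodule.smul_mem _ _ (hmB S)
  refine ⟨⟨_, hmem⟩, rfl, ?_⟩
  have hsum : (⟨_, hmem⟩ : B.domain) = ∑ S ∈ (hY F).toFinset, ψ S • ⟨occVec S, hmB S⟩ := by
    ext1
    simp
  rw [hsum]
  change B.toFun _ = _
  rw [map_sum]
  simp only [map_smul, Function.comp_apply]
  ext T
  simp only [lp.coeFn_sum, Finset.sum_apply, lp.coeFn_smul, Pi.smul_apply, smul_eq_mul,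
    occVec_apply, mul_ite, mul_one, mul_zero, Finset.sum_ite_eq, Set.Finite.mem_toFinset,
    Set.mem_preimage, Finset.mem_coe]
  -- Coordinate T of the image only receives contributions from grade blk T - c: the truncation of ψ
  -- retains all of them if this grade is in F and none otherwise.
  by_cases hT : blk T - c ∈ F
  · rw [if_pos hT]
    refine (hasSum_sum_of_ne_finset_zero fun S hS => ?_).unique (hη T)
    by_contra hne
    have h := hblk S T (hmB S) (right_ne_zero_of_mul hne)
    refine hS ?_
    simpa [show blk S = blk T - c by linarith] using hT
  · rw [if_neg hT]
    refine Finset.sum_eq_zero fun S hS => ?_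
    by_contra hne
    have h := hblk S T (hmB S) (right_ne_zero_of_mul hne)
    refine hT ?_
    simpa [show blk S = blk T - c by linarith] using hS

end Closure

/-! ### Second-quantized operators: excitation energy, closability, core and adjoint. -/

section Quantization

open Classical ContinuousLinearMap

variable {X : Type}

/-- The total energy of a set of excitations. -/
def excitationEnergy (e : X → ℝ) (S : Finset X) : ℝ := ∑ x ∈ S, |e x|

theorem excitationEnergy_insert (e : X → ℝ) {x : X} {S : Finset X} (hx : x ∉ S) :
    excitationEnergy e (insert x S) = |e x| + excitationEnergy e S :=
  Finset.sum_insert hx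

/-- No single excitation exceeds the total energy, so S lies in the power set of a finite set of
modes. -/
theorem finite_excitationEnergy_fiber {e : X → ℝ} (he : ∀ E : ℝ, {x | |e x| ≤ E}.Finite)
    (t : ℝ) : (excitationEnergy e ⁻¹' {t}).Finite := by
  refine ((he t).toFinset.powerset.finite_toSet).subset fun S hS => ?_
  simp only [Set.mem_preimage, Set.mem_singleton_iff] at hS
  simp only [Finset.mem_coe, Finset.mem_powerset]
  intro x hx
  rw [Set.Finite.mem_toFinset, Set.mem_ofPred_eq, ← hS]
  exact Finset.single_le_sum (f := fun z => |e z|) (fun _ _ => abs_nonneg _) hx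

theorem exists_of_annihilate_ne_zero (e : X → ℝ) {x : X} {φ : FockSpace X} {T : Finset X}
    (h : annihilate x φ T ≠ 0) :
    ∃ S, φ S ≠ 0 ∧ excitationEnergy e T = excitationEnergy e S - |e x| := by
  rw [annihilate_apply] at h
  by_cases hx : x ∈ T
  · simp [hx] at h
  · rw [if_neg hx] at h
    exact ⟨_, right_ne_zero_of_mul h, by rw [excitationEnergy_insert e hx]; ring⟩

theorem exists_of_create_ne_zero (e : X → ℝ) {x : X} {φ : FockSpace X} {T : Finset X}
    (h : adjoint (annihilate x) φ T ≠ 0) :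
    ∃ S, φ S ≠ 0 ∧ excitationEnergy e T = excitationEnergy e S + |e x| := by
  rw [create_apply] at h
  by_cases hx : x ∈ T
  · rw [if_pos hx] at h
    refine ⟨_, right_ne_zero_of_mul h, ?_⟩
    conv_lhs => rw [← Finset.insert_erase hx]
    rw [excitationEnergy_insert e (Finset.notMem_erase x T)]
    ring
  · simp [hx] at h

/-- Removing a particle costs |e| = e, while adding a hole contributes |e| = -e; the energy change
is -e in both cases. -/
theorem exists_of_fieldOp_ne_zero {e : X → ℝ} {x : X} {φ : FockSpace X} {T : Finset X}
    (h : fieldOp e x φ T ≠ 0) :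
    ∃ S, φ S ≠ 0 ∧ excitationEnergy e T = excitationEnergy e S - e x := by
  unfold fieldOp at h
  split_ifs at h with hx
  · simpa only [abs_of_pos hx] using exists_of_annihilate_ne_zero e h
  · simpa only [abs_of_nonpos (not_lt.mp hx), ← sub_eq_add_neg] using exists_of_create_ne_zero e h

theorem exists_of_star_fieldOp_ne_zero {e : X → ℝ} {x : X} {φ : FockSpace X} {T : Finset X}
    (h : star (fieldOp e x) φ T ≠ 0) :
    ∃ S, φ S ≠ 0 ∧ excitationEnergy e T = excitationEnergy e S + e x := by
  unfold fieldOp at h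
  split_ifs at h with hx
  · simpa only [abs_of_pos hx] using exists_of_create_ne_zero e h
  · rw [star_eq_adjoint, adjoint_adjoint] at h
    simpa only [abs_of_nonpos (not_lt.mp hx), sub_neg_eq_add] using
      exists_of_annihilate_ne_zero e h

theorem excitationEnergy_of_normalBilinear_ne_zero {e : X → ℝ} {x y : X} {S T : Finset X}
    (h : normalBilinear e x y (occVec S) T ≠ 0) :
    excitationEnergy e T = excitationEnergy e S + (e x - e y) := by
  have hocc : ∀ S', (occVec S : FockSpace X) S' ≠ 0 → S' = S := by
    intro S' h'
    rw [occVec_apply] at h'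
    by_contra hne
    exact h' (if_neg hne)
  by_cases hN : star (fieldOp e x) (fieldOp e y (occVec S)) T = 0
  · have h2 : (if x = y then seaOcc e x else 0) * (occVec S : FockSpace X) T ≠ 0 := by
      intro h2
      refine h ?_
      change star (fieldOp e x) (fieldOp e y (occVec S)) T -
        (if x = y then seaOcc e x else 0) * (occVec S : FockSpace X) T = 0
      rw [hN, h2, sub_zero]
    have hxy : x = y := by
      by_contra hne
      simp [hne] at h2
    rw [hocc T (right_ne_zero_of_mul h2), hxy]
    ring
  · obtain ⟨S₁, h₁, h₁'⟩ := exists_of_star_fieldOp_ne_zero hN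
    obtain ⟨S₂, h₂, h₂'⟩ := exists_of_fieldOp_ne_zero h₁
    rw [h₁', h₂', hocc S₂ h₂]
    ring

/-- The second quantization of the matrix `U`, on all vectors on which its series converges. -/
def quantOp (e : X → ℝ) (U : X → X → ℂ) : FockSpace X →ₗ.[ℂ] FockSpace X where
  domain :=
    { carrier := {φ | Summable fun p : X × X => U p.1 p.2 • normalBilinear e p.1 p.2 φ}
      zero_mem' := by simp [summable_zero]
      add_mem' := by
        intro φ χ h₁ h₂
        simpa using Summable.add h₁ h₂
      smul_mem' := by
        intro c φ h
        simpa [smul_comm _ c] using Summable.const_smul c h }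
  toFun :=
    { toFun := fun φ => secondQuant e U φ
      map_add' := by
        intro φ χ
        simpa [secondQuant] using Summable.tsum_add φ.2 χ.2
      map_smul' := by
        intro c φ
        simpa [secondQuant, smul_comm _ c] using Summable.tsum_const_smul c φ.2 }

theorem hasSum_quantOp (e : X → ℝ) (U : X → X → ℂ) (φ : (quantOp e U).domain) :
    HasSum (fun p : X × X => U p.1 p.2 • normalBilinear e p.1 p.2 φ) (quantOp e U φ) :=
  Summable.hasSum φ.2

/-- The Hermitian conjugate of an infinite matrix. -/
def conjMatrix (U : X → X → ℂ) : X → X → ℂ := fun x y => star (U y x)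

theorem conjMatrix_conjMatrix (U : X → X → ℂ) : conjMatrix (conjMatrix U) = U := by
  funext x y
  simp [conjMatrix]

theorem ShiftsBy.conjMatrix {e : X → ℝ} {c : ℝ} {U : X → X → ℂ} (hU : ShiftsBy e c U) :
    ShiftsBy e (-c) (conjMatrix U) := by
  intro x y h
  have := hU y x fun h' => h (by simp [_root_.conjMatrix, h'])
  linarith

/-- Inner products may be taken term by term on both convergence domains; exchanging x and y then
matches the two scalar series. -/
theorem quantOp_isFormalAdjoint (e : X → ℝ) (U : X → X → ℂ) :
    (quantOp e (conjMatrix U)).IsFormalAdjoint (quantOp e U) := by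
  intro χ φ
  have h₁ := (innerSL ℂ (χ : FockSpace X)).hasSum (hasSum_quantOp e U φ)
  have h₂ := ((innerSL ℂ (φ : FockSpace X)).hasSum (hasSum_quantOp e (conjMatrix U) χ)).star
  have h₃ := (Equiv.prodComm X X).hasSum_iff.mpr h₂
  refine (HasSum.unique ?_ h₁).trans ?_
  rotate_left
  · exact innerSL_apply_apply ..
  · convert h₃ using 1
    · funext p
      simp only [Function.comp_apply, innerSL_apply_apply, Equiv.prodComm_apply, Prod.fst_swap,
        Prod.snd_swap, inner_smul_right, conjMatrix, star_mul', star_star]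
      congr 1
      rw [← star_normalBilinear e p.2 p.1, star_eq_adjoint, adjoint_inner_right]
      exact (inner_conj_symm _ _).symm
    · rw [innerSL_apply_apply]
      exact (inner_conj_symm _ _).symm

theorem secondQuant_vacuum {e : X → ℝ} {c : ℝ} {U : X → X → ℂ} (hU : ShiftsBy e c U) (hc : c ≤ 0) : secondQuant e U (occVec ∅) = 0 := by
  refine (tsum_congr fun p => ?_).trans tsum_zero
  by_cases h : U p.1 p.2 = 0
  · rw [h, zero_smul]
  · have h' := hU _ _ h
    rw [normalBilinear_occVec_eq_zero (Finset.notMem_empty _) (Finset.notMem_empty _)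
      (fun h2 => by linarith [h2.1, h2.2]), smul_zero]

variable {e : X → ℝ} (he : ∀ E : ℝ, {x | |e x| ≤ E}.Finite) {c : ℝ} {U : X → X → ℂ}
  (hU : ShiftsBy e c U)

include he hU

theorem finiteVectors_le_domain : finiteVectors X ≤ (quantOp e U).domain :=
  fun _ hφ => summable_secondQuant he hU hφ

theorem quantOp_restrict_adjoint :
    ((quantOp e U).domRestrict (finiteVectors X)).IsClosable ∧
      ((quantOp e (conjMatrix U)).domRestrict (finiteVectors X)).adjoint =
        ((quantOp e U).domRestrict (finiteVectors X)).closure := by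
  refine adjoint_eq_closure_of_shift ?_ ?_ ?_ (finite_excitationEnergy_fiber he) c ?_
  · exact inf_eq_left.mpr (finiteVectors_le_domain he hU.conjMatrix)
  · exact inf_eq_left.mpr (finiteVectors_le_domain he hU)
  · intro χ φ
    exact quantOp_isFormalAdjoint e U ⟨χ, χ.2.2⟩ ⟨φ, φ.2.2⟩
  · intro S T h hne
    by_contra hE
    refine hne ?_
    have h₁ := (innerSL ℂ (occVec T : FockSpace X)).hasSum (hasSum_quantOp e U ⟨occVec S, h.2⟩)
    rw [innerSL_apply_apply, inner_occVec_left] at h₁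
    refine h₁.unique ?_
    convert hasSum_zero with p
    rw [innerSL_apply_apply, inner_occVec_left]
    change U p.1 p.2 * normalBilinear e p.1 p.2 (occVec S) T = 0
    by_contra hp
    have h₂ := hU _ _ (left_ne_zero_of_mul hp)
    have h₃ := excitationEnergy_of_normalBilinear_ne_zero (right_ne_zero_of_mul hp)
    exact hE (by linarith)

theorem quantOp_le_adjoint :
    quantOp e U ≤ ((quantOp e (conjMatrix U)).domRestrict (finiteVectors X)).adjoint := by
  refine LinearPMap.IsFormalAdjoint.le_adjoint ?_ fun χ φ => ?_
  · rw [LinearPMap.domRestrict_domain,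
      inf_eq_left.mpr (finiteVectors_le_domain he hU.conjMatrix)]
    exact dense_finiteVectors
  · exact quantOp_isFormalAdjoint e U ⟨χ, χ.2.2⟩ φ

theorem dense_restrict_domain :
    Dense (((quantOp e U).domRestrict (finiteVectors X)).domain : Set (FockSpace X)) := by
  rw [LinearPMap.domRestrict_domain, inf_eq_left.mpr (finiteVectors_le_domain he hU)]
  exact dense_finiteVectors

theorem quantOp_isClosable : (quantOp e U).IsClosable :=
  (LinearPMap.adjoint_isClosed (dense_restrict_domain he hU.conjMatrix)).isClosable.leIsClosable
    (quantOp_le_adjoint he hU)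

/-- The maximal operator extends its restriction and is contained in the adjoint of the restricted
conjugate, which is already the closure of that restriction. -/
theorem quantOp_closure :
    (quantOp e U).closure = ((quantOp e U).domRestrict (finiteVectors X)).closure := by
  apply le_antisymm
  · rw [← (quantOp_restrict_adjoint he hU).2]
    exact LinearPMap.closure_le_of_isClosed (quantOp_le_adjoint he hU)
      (LinearPMap.adjoint_isClosed (dense_restrict_domain he hU.conjMatrix))
  · exact (quantOp_isClosable he hU).closure_mono LinearPMap.domRestrict_le

theorem quantOp_hasCore : (quantOp e U).closure.HasCore (finiteVectors X) where
  le_domain := (finiteVectors_le_domain he hU).trans (LinearPMap.le_closure _).1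
  closure_eq := by
    have h : (quantOp e U).closure.domRestrict (finiteVectors X) =
        (quantOp e U).domRestrict (finiteVectors X) := by
      have hle := LinearPMap.le_closure (quantOp e U)
      refine (LinearPMap.eq_of_le_of_domain_eq ⟨?_, ?_⟩ ?_).symm
      · exact inf_le_inf_left _ hle.1
      · intro x y hxy
        exact hle.2 (x := ⟨x, x.2.2⟩) (y := ⟨y, y.2.2⟩) hxy
      · rw [LinearPMap.domRestrict_domain, LinearPMap.domRestrict_domain,
          inf_eq_left.mpr (finiteVectors_le_domain he hU),
          inf_eq_left.mpr ((finiteVectors_le_domain he hU).trans hle.1)]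
    rw [h, quantOp_closure he hU]

/-- One inclusion holds because the adjoint reverses extensions. For the other, the closure is
itself the adjoint of the restricted conjugate operator, hence formally adjoint to it. -/
theorem quantOp_closure_adjoint :
    (quantOp e U).closure.adjoint = (quantOp e (conjMatrix U)).closure := by
  have h := (quantOp_restrict_adjoint he hU.conjMatrix).2
  rw [conjMatrix_conjMatrix] at h
  have hd := dense_restrict_domain he hU
  rw [quantOp_closure he hU, quantOp_closure he hU.conjMatrix]
  apply le_antisymm
  · rw [← h]
    exact LinearPMap.adjoint_antitone hd (LinearPMap.le_closure _)
  · have hd' := hd.mono (LinearPMap.le_closure _).1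
    refine LinearPMap.closure_le_of_isClosed ?_ (LinearPMap.adjoint_isClosed hd')
    refine LinearPMap.IsFormalAdjoint.le_adjoint hd' ?_
    rw [← (quantOp_restrict_adjoint he hU).2]
    exact LinearPMap.adjoint_isFormalAdjoint (dense_restrict_domain he hU.conjMatrix)

theorem mem_closure_domain {φ : FockSpace X} (hφ : φ ∈ finiteVectors X) :
    φ ∈ (quantOp e U).closure.domain :=
  (quantOp_hasCore he hU).le_domain hφ

theorem act_quantOp_closure {φ : FockSpace X} (hφ : φ ∈ finiteVectors X) :
    act (quantOp e U).closure φ = secondQuant e U φ := by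
  rw [act, dif_pos (mem_closure_domain he hU hφ)]
  exact ((LinearPMap.le_closure (quantOp e U)).2
    (x := ⟨φ, finiteVectors_le_domain he hU hφ⟩) rfl).symm

end Quantization

/-! ### Nodal momenta modulo umklapp, the translation matrices and spectral flow. -/

section NodalModes

open Classical

variable {L a : ℝ}

theorem Int.neg_units_ne_self (s : ℤˣ) : -s ≠ s := by
  rcases Int.units_eq_one_or s with rfl | rfl <;> decide

theorem Int.units_eq_or_eq_neg (t s : ℤˣ) : t = s ∨ t = -s := by
  rcases Int.units_eq_one_or s with rfl | rfl <;> rcases Int.units_eq_one_or t with rfl | rfl <;>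
    decide

theorem eq_smul_unitVec_iff (s : ℤˣ) (q : ℤˣ → ℝ) (c : ℝ) :
    q = c • unitVec (-s) ↔ q s = 0 ∧ q (-s) = c := by
  constructor
  · rintro rfl
    simp [unitVec, (Int.neg_units_ne_self s).symm]
  · rintro ⟨h₁, h₂⟩
    funext t
    rcases Int.units_eq_or_eq_neg t s with rfl | rfl
    · simp [unitVec, h₁, (Int.neg_units_ne_self t).symm]
    · simp [unitVec, h₂]

/-- Equality modulo the reciprocal vectors `2πn e_{-s}/a`. -/
def UmklappEq (a : ℝ) (s : ℤˣ) (q q' : ℤˣ → ℝ) : Prop :=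
  ∃ n : ℤ, q = q' + (2 * Real.pi * n / a) • unitVec (-s)

theorem umklappEq_iff {s : ℤˣ} {q q' : ℤˣ → ℝ} :
    UmklappEq a s q q' ↔ q s = q' s ∧ ∃ n : ℤ, q (-s) = q' (-s) + 2 * Real.pi * n / a := by
  have h : ∀ n : ℤ, q = q' + (2 * Real.pi * n / a) • unitVec (-s) ↔
      q s = q' s ∧ q (-s) = q' (-s) + 2 * Real.pi * n / a := fun n => by
    rw [← sub_eq_iff_eq_add', eq_smul_unitVec_iff, Pi.sub_apply, Pi.sub_apply, sub_eq_zero,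
      sub_eq_iff_eq_add']
  simp only [UmklappEq, h, exists_and_left]

theorem UmklappEq.add_right {s : ℤˣ} {q q' : ℤˣ → ℝ} (h : UmklappEq a s q q') (v : ℤˣ → ℝ) :
    UmklappEq a s (q + v) (q' + v) := by
  obtain ⟨n, rfl⟩ := h
  exact ⟨n, by abel⟩

theorem UmklappEq.symm {s : ℤˣ} {q q' : ℤˣ → ℝ} (h : UmklappEq a s q q') :
    UmklappEq a s q' q := by
  obtain ⟨n, rfl⟩ := h
  refine ⟨-n, ?_⟩
  rw [add_assoc, ← add_smul, Int.cast_neg, mul_neg, neg_div, add_neg_cancel, zero_smul, add_zero]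

theorem UmklappEq.trans {s : ℤˣ} {q q' q'' : ℤˣ → ℝ} (h : UmklappEq a s q q')
    (h' : UmklappEq a s q' q'') : UmklappEq a s q q'' := by
  obtain ⟨n, rfl⟩ := h
  obtain ⟨m, rfl⟩ := h'
  refine ⟨m + n, ?_⟩
  rw [add_assoc, ← add_smul]
  push_cast
  congr 2
  ring

theorem umklapp_index_unique (ha : 0 < a) {s : ℤˣ} {q q' : ℤˣ → ℝ} {n m : ℤ}
    (hn : q = q' + (2 * Real.pi * n / a) • unitVec (-s))
    (hm : q = q' + (2 * Real.pi * m / a) • unitVec (-s)) : n = m := by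
  have h := congrFun (hn.symm.trans hm) (-s)
  simp only [Pi.add_apply, Pi.smul_apply, unitVec, Pi.single_eq_same, smul_eq_mul, mul_one,
    add_right_inj] at h
  have hpi := Real.pi_pos
  field_simp at h
  exact_mod_cast h

theorem umklappDelta_eq (ha : 0 < a) (s : ℤˣ) (q : ℤˣ → ℝ) :
    umklappDelta a s q = if UmklappEq a s q 0 then 1 else 0 := by
  unfold umklappDelta
  by_cases h : UmklappEq a s q 0
  · obtain ⟨n, hn⟩ := h
    rw [if_pos ⟨n, hn⟩, tsum_eq_single n, if_pos (by simpa using hn)]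
    intro m hm
    exact if_neg fun h' => hm (umklapp_index_unique ha (by simpa using h') hn)
  · rw [if_neg h]
    refine (tsum_congr fun n => if_neg fun hn => h ⟨n, ?_⟩).trans tsum_zero
    simpa using hn

/-- The transverse component is reduced modulo 2π/a. The half-integer lattice is preserved because
2π/a is M steps of size 2π/L; this is where integrality of L/a enters. -/
theorem exists_umklappEq (hL : 0 < L) (ha : 0 < a) {M : ℕ} (hM : L = M * a) {s : ℤˣ}
    (k : fermionMomenta L a s) {p : ℤˣ → ℝ} (hp : p ∈ bosonMomenta L) :
    ∃ k' : fermionMomenta L a s, UmklappEq a s (k.1 + p) k'.1 := by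
  have hpos : 0 < 2 * Real.pi / a := by positivity
  have hkp : ∀ t, ∃ m : ℤ, (k.1 + p) t = 2 * Real.pi / L * (m + 1 / 2) := fun t => by
    obtain ⟨m, hm⟩ := k.2.1 t
    obtain ⟨n, hn⟩ := hp t
    exact ⟨m + n, by rw [Pi.add_apply, hm, hn]; push_cast; ring⟩
  have hmem := toIcoMod_mem_Ico hpos (-(Real.pi / a)) ((k.1 + p) (-s))
  have hdiv := self_sub_toIcoDiv_zsmul hpos (-(Real.pi / a)) ((k.1 + p) (-s))
  set d := toIcoDiv hpos (-(Real.pi / a)) ((k.1 + p) (-s))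
  set y := toIcoMod hpos (-(Real.pi / a)) ((k.1 + p) (-s))
  have hs := Int.neg_units_ne_self s
  refine ⟨⟨fun t => if t = s then (k.1 + p) s else y, fun t => ?_, ?_, ?_⟩, ?_⟩
  · by_cases ht : t = s
    · simpa [ht] using hkp s
    · obtain ⟨m, hm⟩ := hkp (-s)
      refine ⟨m - d * M, ?_⟩
      have hM0 : (M : ℝ) ≠ 0 := fun h => by rw [h, zero_mul] at hM; exact hL.ne' hM
      simp only [if_neg ht]
      rw [← hdiv, hm, hM, zsmul_eq_mul]
      push_cast
      field_simp
      ring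
  · simpa [hs] using hmem.1
  · have h2 : -(Real.pi / a) + 2 * Real.pi / a = Real.pi / a := by ring
    simpa [hs, h2] using hmem.2
  · rw [umklappEq_iff]
    refine ⟨by simp, d, ?_⟩
    simp only [hs, if_false]
    rw [← hdiv, zsmul_eq_mul]
    ring

/-- The half-open zone is exactly one reciprocal period wide, so the umklapp integer lies strictly
between -1 and 1. -/
theorem fermionMomenta_eq_of_umklappEq (ha : 0 < a) {s : ℤˣ} {k k' : fermionMomenta L a s}
    (h : UmklappEq a s k.1 k'.1) : k = k' := by
  obtain ⟨h₁, n, h₂⟩ := umklappEq_iff.mp h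
  have hk := k.2.2
  have hk' := k'.2.2
  have hpi := Real.pi_pos
  have hw : 0 < Real.pi / a := by positivity
  have h3 : 2 * Real.pi * n / a = (Real.pi / a) * (2 * n) := by ring
  have hn : n = 0 := by
    have h4 : (n : ℝ) < 1 := by
      by_contra hc
      nlinarith [mul_le_mul_of_nonneg_left (not_lt.mp hc) hw.le]
    have h5 : (-1 : ℝ) < n := by
      by_contra hc
      nlinarith [mul_le_mul_of_nonneg_left (not_lt.mp hc) hw.le]
    have h4' : n < 1 := by exact_mod_cast h4
    have h5' : -1 < n := by exact_mod_cast h5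
    omega
  ext t
  rcases Int.units_eq_or_eq_neg t s with rfl | rfl
  · exact h₁
  · simpa [hn] using h₂

/-- The fermion momentum with quantum number `m` along `e_s` and `i`-th allowed component along
`e_{-s}`. -/
def latticeMomentum (L : ℝ) (M : ℕ) (s : ℤˣ) (m : ℤ) (i : Fin M) : ℤˣ → ℝ := fun t =>
  -- The allowed transverse integers j satisfy -M ≤ 2j + 1 < M; the floor of (M + 1)/2 is the right
  -- offset for both parities of M.
  2 * Real.pi / L * (((if t = s then m else (i : ℤ) - (M + 1 : ℤ) / 2 : ℤ) : ℝ) + 1 / 2)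

theorem pi_div_eq (ha : 0 < a) {M : ℕ} (hM0 : 0 < M) (hM : L = M * a) :
    Real.pi / a = 2 * Real.pi / L * (M / 2) := by
  have : (0 : ℝ) < M := by exact_mod_cast hM0
  rw [hM]
  field_simp

theorem latticeMomentum_mem (hL : 0 < L) (ha : 0 < a) {M : ℕ} (hM : L = M * a) (s : ℤˣ) (m : ℤ)
    (i : Fin M) : latticeMomentum L M s m i ∈ fermionMomenta L a s := by
  have hi := i.2
  have hw : 0 < 2 * Real.pi / L := by positivity
  refine ⟨fun t => ⟨_, rfl⟩, ?_, ?_⟩ <;>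
    simp only [latticeMomentum, if_neg (Int.neg_units_ne_self s), pi_div_eq ha (by omega) hM]
  · rw [← mul_neg]
    refine mul_le_mul_of_nonneg_left ?_ hw.le
    have : -(M : ℤ) ≤ 2 * ((i : ℤ) - (M + 1 : ℤ) / 2) + 1 := by omega
    have : -(M : ℝ) ≤ 2 * (((i : ℤ) - (M + 1 : ℤ) / 2 : ℤ) : ℝ) + 1 := by exact_mod_cast this
    linarith
  · refine mul_lt_mul_of_pos_left ?_ hw
    have : 2 * ((i : ℤ) - (M + 1 : ℤ) / 2) + 1 < (M : ℤ) := by omega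
    have : 2 * (((i : ℤ) - (M + 1 : ℤ) / 2 : ℤ) : ℝ) + 1 < (M : ℝ) := by exact_mod_cast this
    linarith

theorem exists_latticeMomentum (hL : 0 < L) (ha : 0 < a) {M : ℕ} (hM0 : 0 < M) (hM : L = M * a)
    {s : ℤˣ} (k : fermionMomenta L a s) : ∃ m i, latticeMomentum L M s m i = k.1 := by
  obtain ⟨m, hm⟩ := k.2.1 s
  obtain ⟨j, hj⟩ := k.2.1 (-s)
  have hw : 0 < 2 * Real.pi / L := by positivity
  obtain ⟨h₁, h₂⟩ := k.2.2
  rw [hj, pi_div_eq ha hM0 hM] at h₁ h₂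
  rw [← mul_neg] at h₁
  have h₁ := le_of_mul_le_mul_left h₁ hw
  have h₂ := lt_of_mul_lt_mul_left h₂ hw.le
  have h₁' : -(M : ℤ) ≤ 2 * j + 1 := by
    have : -(M : ℝ) ≤ 2 * j + 1 := by linarith
    exact_mod_cast this
  have h₂' : 2 * j + 1 < (M : ℤ) := by
    have : 2 * (j : ℝ) + 1 < M := by linarith
    exact_mod_cast this
  refine ⟨m, ⟨(j + (M + 1 : ℤ) / 2).toNat, by omega⟩, ?_⟩
  funext t
  rcases Int.units_eq_or_eq_neg t s with rfl | rfl
  · simp [latticeMomentum, hm]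
  · have h3 : (((j + (M + 1 : ℤ) / 2).toNat : ℕ) : ℤ) - (M + 1 : ℤ) / 2 = j := by omega
    simp only [latticeMomentum, if_neg (Int.neg_units_ne_self s), h3, hj]

theorem latticeMomentum_injective (hL : 0 < L) {M : ℕ} {s : ℤˣ} {m m' : ℤ} {i i' : Fin M}
    (h : latticeMomentum L M s m i = latticeMomentum L M s m' i') : m = m' ∧ i = i' := by
  have hw : 2 * Real.pi / L ≠ 0 := by positivity
  have h₁ := mul_left_cancel₀ hw (congrFun h s)
  have h₂ := mul_left_cancel₀ hw (congrFun h (-s))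
  simp only [if_true, add_left_inj, Int.cast_inj, Int.neg_units_ne_self, if_false] at h₁ h₂
  exact ⟨h₁, Fin.ext (by omega)⟩

/-- The energy `r k_s` of a nodal mode. -/
def modeEnergy (x : NodalMode L a) : ℝ := ((x.r : ℤ) : ℝ) * x.k.1 x.s

theorem abs_units_mul (r : ℤˣ) (x : ℝ) : |((r : ℤ) : ℝ) * x| = |x| := by
  rcases Int.units_eq_one_or r with rfl | rfl <;> simp

theorem finite_modeEnergy_le (hL : 0 < L) (ha : 0 < a) {M : ℕ} (hM0 : 0 < M) (hM : L = M * a)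
    (E : ℝ) : {x : NodalMode L a | |modeEnergy x| ≤ E}.Finite := by
  have hw : 0 < 2 * Real.pi / L := by positivity
  -- The extra 1 absorbs the half-integer offset of the levels.
  obtain ⟨N, hN⟩ := exists_nat_gt (E / (2 * Real.pi / L) + 1)
  let f : ℤˣ × ℤˣ × Fin 2 × Fin M × ℤ → NodalMode L a := fun q =>
    ⟨q.1, q.2.1, q.2.2.1, ⟨latticeMomentum L M q.2.1 q.2.2.2.2 q.2.2.2.1,
      latticeMomentum_mem hL ha hM _ _ _⟩⟩
  refine (((Set.finite_univ (α := ℤˣ)).prod ((Set.finite_univ (α := ℤˣ)).prod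
    ((Set.finite_univ (α := Fin 2)).prod ((Set.finite_univ (α := Fin M)).prod
      (Set.finite_Icc (-(N : ℤ)) N))))).image f).subset ?_
  rintro ⟨r, s, α, k⟩ hx
  obtain ⟨m, i, hk⟩ := exists_latticeMomentum hL ha hM0 hM k
  refine ⟨(r, s, α, i, m), ?_, ?_⟩
  · rw [Set.mem_ofPred_eq, modeEnergy, abs_units_mul] at hx
    simp only at hx
    rw [← hk, latticeMomentum, if_pos rfl, abs_mul, abs_of_pos hw, mul_comm, ← le_div_iff₀ hw,
      abs_le] at hx
    have h₁ : (-(N : ℤ) : ℝ) ≤ m := by push_cast; linarith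
    have h₂ : (m : ℝ) ≤ N := by linarith
    simp only [Set.mem_prod, Set.mem_univ, true_and, Set.mem_Icc]
    exact ⟨by exact_mod_cast h₁, by exact_mod_cast h₂⟩
  · simp only [f, hk]

/-- The one-particle matrix of the nodal bilinear with spin matrix `σ`. -/
def nodalMatrix (L a : ℝ) (σ : Matrix (Fin 2) (Fin 2) ℂ) (r s : ℤˣ) (p : ℤˣ → ℝ) :
    NodalMode L a → NodalMode L a → ℂ := fun x y =>
  if (x.r = r ∧ x.s = s) ∧ (y.r = r ∧ y.s = s) ∧ UmklappEq a s (x.k.1 + p) y.k.1 then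
    σ x.α y.α else 0

theorem of_nodalMatrix_ne_zero {σ : Matrix (Fin 2) (Fin 2) ℂ} {r s : ℤˣ} {p : ℤˣ → ℝ}
    {x y : NodalMode L a} (h : nodalMatrix L a σ r s p x y ≠ 0) :
    (x.r = r ∧ x.s = s) ∧ (y.r = r ∧ y.s = s) ∧ UmklappEq a s (x.k.1 + p) y.k.1 := by
  by_contra h'
  exact h (if_neg h')

theorem shiftsBy_nodalMatrix (σ : Matrix (Fin 2) (Fin 2) ℂ) (r s : ℤˣ) (p : ℤˣ → ℝ) :
    ShiftsBy modeEnergy (-(((r : ℤ) : ℝ) * p s)) (nodalMatrix L a σ r s p) := by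
  rintro ⟨r₁, s₁, α, k⟩ ⟨r₂, s₂, β, k'⟩ h
  obtain ⟨⟨rfl, rfl⟩, ⟨rfl, rfl⟩, h₅⟩ := of_nodalMatrix_ne_zero h
  have h₆ := (umklappEq_iff.mp h₅).1
  rw [Pi.add_apply] at h₆
  rw [modeEnergy, modeEnergy, ← h₆]
  ring

theorem conjMatrix_nodalMatrix (σ : Matrix (Fin 2) (Fin 2) ℂ) (r s : ℤˣ) (p : ℤˣ → ℝ) :
    conjMatrix (nodalMatrix L a σ r s p) = nodalMatrix L a σ.conjTranspose r s (-p) := by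
  funext x y
  have h : ∀ q q' : ℤˣ → ℝ, UmklappEq a s (q' + p) q ↔ UmklappEq a s (q + -p) q' := by
    intro q q'
    constructor
    · intro h
      simpa using h.symm.add_right (-p)
    · intro h
      simpa using h.symm.add_right p
  unfold conjMatrix nodalMatrix
  rw [apply_ite star, star_zero]
  refine if_congr ?_ rfl rfl
  rw [h]
  tauto

/-- The representative k' of k + p is the only possible intermediate momentum, so the sum over modes
collapses to the spin sum of a 2 × 2 matrix product. -/
theorem hasSum_nodalMatrix_mul (hL : 0 < L) (ha : 0 < a) {M : ℕ} (hM : L = M * a)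
    (σ τ : Matrix (Fin 2) (Fin 2) ℂ) (r s : ℤˣ) {p : ℤˣ → ℝ} (hp : p ∈ bosonMomenta L)
    (p' : ℤˣ → ℝ) (x w : NodalMode L a) :
    HasSum (fun y => nodalMatrix L a σ r s p x y * nodalMatrix L a τ r s p' y w)
      (nodalMatrix L a (σ * τ) r s (p + p') x w) := by
  by_cases hx : x.r = r ∧ x.s = s
  swap
  · simp only [nodalMatrix, hx, false_and, if_false, zero_mul]
    exact hasSum_zero
  obtain ⟨r', s', α, k⟩ := x
  obtain ⟨rfl, rfl⟩ : r' = r ∧ s' = s := hx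
  obtain ⟨k', hk'⟩ := exists_umklappEq hL ha hM k hp
  have hinj : Function.Injective fun γ : Fin 2 => (⟨r', s', γ, k'⟩ : NodalMode L a) :=
    fun γ γ' h => congrArg NodalMode.α h
  rw [← hinj.hasSum_iff]
  · have hiff : UmklappEq a s' (k'.1 + p') w.k.1 ↔ UmklappEq a s' (k.1 + (p + p')) w.k.1 := by
      rw [← add_assoc]
      exact ⟨fun h => (hk'.add_right p').trans h, fun h => (hk'.symm.add_right p').trans h⟩
    convert hasSum_fintype _ using 1
    simp only [Function.comp_apply, nodalMatrix, and_self, hk', true_and, if_true, hiff]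
    split_ifs
    · rw [Matrix.mul_apply]
    · simp
  · rintro ⟨r₁, s₁, γ, k₁⟩ hy
    by_contra hne
    obtain ⟨-, ⟨rfl, rfl⟩, h⟩ := of_nodalMatrix_ne_zero (left_ne_zero_of_mul hne)
    exact hy ⟨γ, by rw [fermionMomenta_eq_of_umklappEq ha (hk'.symm.trans h)]⟩

theorem nodalMatrix_mul_eq_zero {σ τ : Matrix (Fin 2) (Fin 2) ℂ} {r s r' s' : ℤˣ}
    (h : (r, s) ≠ (r', s')) (p p' : ℤˣ → ℝ) (x y w : NodalMode L a) :
    nodalMatrix L a σ r s p x y * nodalMatrix L a τ r' s' p' y w = 0 := by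
  by_contra hne
  obtain ⟨-, ⟨h₁, h₂⟩, -⟩ := of_nodalMatrix_ne_zero (left_ne_zero_of_mul hne)
  obtain ⟨⟨h₃, h₄⟩, -⟩ := of_nodalMatrix_ne_zero (right_ne_zero_of_mul hne)
  exact h (by rw [← h₁, ← h₂, h₃, h₄])

/-- Occupation in the Dirac sea of chirality `r` of the level with quantum number `m`. -/
def levelOcc (r : ℤˣ) (m : ℤ) : ℂ := if 0 < ((r : ℤ) : ℝ) * ((m : ℝ) + 1 / 2) then 0 else 1

/-- The energies m + 1/2 change sign only between m = -1 and m = 0. -/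
theorem levelOcc_sub_succ (r : ℤˣ) (m : ℤ) :
    levelOcc r m - levelOcc r (m + 1) = if m = -1 then ((r : ℤ) : ℂ) else 0 := by
  have h₁ : ∀ m : ℤ, 0 < (m : ℝ) + 1 / 2 ↔ 0 ≤ m := fun m => by
    constructor
    · intro h
      have : (-1 : ℝ) < m := by linarith
      have : -1 < m := by exact_mod_cast this
      omega
    · intro h
      have : (0 : ℝ) ≤ m := by exact_mod_cast h
      linarith
  have h₂ : ∀ m : ℤ, 0 < -((m : ℝ) + 1 / 2) ↔ m < 0 := fun m => by
    constructor
    · intro h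
      have : (m : ℝ) < 0 := by linarith
      exact_mod_cast this
    · intro h
      have : (m : ℝ) ≤ -1 := by exact_mod_cast (by omega : m ≤ -1)
      linarith
  rcases Int.units_eq_one_or r with rfl | rfl
  · simp only [levelOcc, Units.val_one, Int.cast_one, one_mul, h₁]
    rcases lt_trichotomy m (-1) with h | h | h
    · simp [h.ne, show ¬ 0 ≤ m by omega, show ¬ 0 ≤ m + 1 by omega]
    · simp [h]
    · simp [h.ne', show 0 ≤ m by omega, show 0 ≤ m + 1 by omega]
  · simp only [levelOcc, Units.val_neg, Units.val_one, Int.cast_neg, Int.cast_one, neg_mul,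
      one_mul, h₂]
    rcases lt_trichotomy m (-1) with h | h | h
    · simp [h.ne, show m < 0 by omega, show m + 1 < 0 by omega]
    · simp [h]
    · simp [h.ne', show ¬ m < 0 by omega, show ¬ m + 1 < 0 by omega]

theorem hasSum_levelOcc_sub_succ (r : ℤˣ) (q : ℤ) :
    HasSum (fun m => levelOcc r (m + q) - levelOcc r (m + q + 1)) ((r : ℤ) : ℂ) := by
  simp only [levelOcc_sub_succ, show ∀ m : ℤ, m + q = -1 ↔ m = -1 - q by omega]
  exact hasSum_ite_eq _ _

/-- The spectral flow of the Dirac sea under a shift of the levels. -/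
theorem hasSum_levelOcc_sub (r : ℤˣ) (q : ℤ) :
    HasSum (fun m => levelOcc r m - levelOcc r (m + q)) (((r : ℤ) : ℂ) * q) := by
  induction q using Int.induction_on with
  | zero => simp [hasSum_zero]
  | succ i ih =>
    convert ih.add (hasSum_levelOcc_sub_succ r i) using 1
    · funext m
      rw [← add_assoc]
      ring
    · push_cast
      ring
  | pred i ih =>
    have h := ih.sub (hasSum_levelOcc_sub_succ r (-i - 1))
    have h₁ : (fun m => levelOcc r m - levelOcc r (m + (-(i : ℤ) - 1))) = fun m =>
        levelOcc r m - levelOcc r (m + -i) -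
          (levelOcc r (m + (-i - 1)) - levelOcc r (m + (-i - 1) + 1)) := by
      funext m
      rw [show m + (-(i : ℤ) - 1) + 1 = m + -i by ring]
      ring
    have h₂ : ((r : ℤ) : ℂ) * ((-(i : ℤ) - 1 : ℤ) : ℂ) =
        ((r : ℤ) : ℂ) * ((-(i : ℤ) : ℤ) : ℂ) - ((r : ℤ) : ℂ) := by
      push_cast
      ring
    rw [h₁, h₂]
    exact h

theorem hasSum_mul_levelOcc_sub {ι : Type*} [Fintype ι] (f : ι → ℂ) (r : ℤˣ) (q : ℤ) :
    HasSum (fun x : ι × ℤ => f x.1 * (levelOcc r x.2 - levelOcc r (x.2 + q)))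
      ((∑ i, f i) * (((r : ℤ) : ℂ) * q)) := by
  have hg := hasSum_levelOcc_sub r q
  have hs := summable_mul_of_summable_norm (f := f)
    (g := fun m => levelOcc r m - levelOcc r (m + q)) (hasSum_fintype fun i => ‖f i‖).summable
    hg.summable.norm
  exact HasSum.mul (f := f) (g := fun m => levelOcc r m - levelOcc r (m + q))
    (hasSum_fintype f) hg hs

/-- A round trip k → k + p → k + p + p' must return to k modulo umklapp, which gives the delta. Then
the sum factorizes: spins give tr(στ), transverse momenta give M, and levels give the spectral flow
r l with p_s = 2πl/L. -/
theorem hasSum_schwinger (hL : 0 < L) (ha : 0 < a) {M : ℕ} (hM0 : 0 < M) (hM : L = M * a)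
    (σ τ : Matrix (Fin 2) (Fin 2) ℂ) (r s : ℤˣ) {p : ℤˣ → ℝ} (hp : p ∈ bosonMomenta L)
    (p' : ℤˣ → ℝ) :
    HasSum (fun q : NodalMode L a × NodalMode L a =>
      nodalMatrix L a σ r s p q.1 q.2 * nodalMatrix L a τ r s p' q.2 q.1 *
        (seaOcc modeEnergy q.1 - seaOcc modeEnergy q.2))
      ((σ * τ).trace * (((((r : ℤ) : ℝ) * p s * (L / (2 * Real.pi)) * (L / a) : ℝ) : ℂ) *
        umklappDelta a s (p + p'))) := by
  rw [umklappDelta_eq ha]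
  by_cases hpp : UmklappEq a s (p + p') 0
  swap
  · rw [if_neg hpp, mul_zero, mul_zero]
    convert hasSum_zero with q
    by_contra hne
    have h := left_ne_zero_of_mul hne
    obtain ⟨⟨h₁, h₂⟩, ⟨h₃, h₄⟩, h₅⟩ := of_nodalMatrix_ne_zero (left_ne_zero_of_mul h)
    obtain ⟨-, -, h₆⟩ := of_nodalMatrix_ne_zero (right_ne_zero_of_mul h)
    have h₇ := ((h₅.add_right p').trans h₆).add_right (-q.1.k.1)
    refine hpp ?_
    convert h₇ using 1 <;> abel
  rw [if_pos hpp, mul_one]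
  obtain ⟨l, hl⟩ := hp s
  have hw : 0 < 2 * Real.pi / L := by positivity
  choose shift hshift using fun k : fermionMomenta L a s => exists_umklappEq hL ha hM k hp
  let κ : ℤ → Fin M → fermionMomenta L a s := fun m i =>
    ⟨latticeMomentum L M s m i, latticeMomentum_mem hL ha hM s m i⟩
  -- The range of `j` contains the support of the series: spins are free, and the second momentum is
  -- determined by the first.
  let j : (Fin 2 × Fin 2 × Fin M) × ℤ → NodalMode L a × NodalMode L a := fun q =>
    (⟨r, s, q.1.1, κ q.2 q.1.2.2⟩, ⟨r, s, q.1.2.1, shift (κ q.2 q.1.2.2)⟩)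
  have hj : Function.Injective j := by
    rintro ⟨⟨α, β, i⟩, m⟩ ⟨⟨α', β', i'⟩, m'⟩ h
    simp only [j, Prod.mk.injEq, NodalMode.mk.injEq, heq_eq_eq, true_and] at h
    obtain ⟨⟨rfl, h₁⟩, rfl, -⟩ := h
    obtain ⟨rfl, rfl⟩ := latticeMomentum_injective hL (congrArg Subtype.val h₁)
    rfl
  rw [← hj.hasSum_iff]
  · have hocc : ∀ (β : Fin 2) (k : fermionMomenta L a s) (m : ℤ),
        k.1 s = 2 * Real.pi / L * (m + 1 / 2) →
        seaOcc modeEnergy (⟨r, s, β, k⟩ : NodalMode L a) = levelOcc r m := by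
      intro β k m hk
      unfold seaOcc levelOcc modeEnergy
      simp only [hk]
      rw [mul_left_comm]
      exact if_congr (mul_pos_iff_of_pos_left hw) rfl rfl
    have hsum := hasSum_mul_levelOcc_sub
      (fun q : Fin 2 × Fin 2 × Fin M => σ q.1 q.2.1 * τ q.2.1 q.1) r l
    convert hsum using 1
    · funext ⟨⟨α, β, i⟩, m⟩
      have h₁ := hshift (κ m i)
      have h₂ : UmklappEq a s ((shift (κ m i)).1 + p') (κ m i).1 := by
        have h := hpp.add_right (κ m i).1
        rw [zero_add, add_comm, ← add_assoc] at h
        exact (h₁.symm.add_right p').trans h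
      have h₃ : (κ m i).1 s = 2 * Real.pi / L * (m + 1 / 2) := by
        simp [κ, latticeMomentum]
      have h₄ : (shift (κ m i)).1 s = 2 * Real.pi / L * ((m + l : ℤ) + 1 / 2) := by
        rw [← (umklappEq_iff.mp h₁).1, Pi.add_apply, h₃, hl]
        push_cast
        ring
      simp only [j, Function.comp_apply, nodalMatrix, h₁, h₂, and_self, if_true,
        hocc _ _ _ h₃, hocc _ _ _ h₄]
    · have h₁ : ((r : ℤ) : ℝ) * p s * (L / (2 * Real.pi)) * (L / a) = ((r : ℤ) : ℝ) * l * M := by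
        have hLa : L / a = M := by rw [hM]; field_simp
        have hpi := Real.pi_pos
        rw [hl, hLa]
        field_simp
      rw [h₁]
      simp only [Fintype.sum_prod_type, Finset.sum_const, Finset.card_univ, Fintype.card_fin,
        Matrix.trace, Matrix.diag, Matrix.mul_apply, nsmul_eq_mul, ← Finset.mul_sum]
      push_cast
      ring
  · rintro ⟨⟨r₁, s₁, α, k⟩, ⟨r₂, s₂, β, k'⟩⟩ hq
    by_contra hne
    have h := left_ne_zero_of_mul hne
    obtain ⟨⟨h₁, h₂⟩, ⟨h₃, h₄⟩, h₅⟩ := of_nodalMatrix_ne_zero (left_ne_zero_of_mul h)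
    simp only at h₁ h₂ h₃ h₄ h₅
    subst h₁ h₂ h₃ h₄
    obtain ⟨m, i, hk⟩ := exists_latticeMomentum hL ha hM0 hM k
    obtain rfl : κ m i = k := Subtype.ext hk
    refine hq ⟨((α, β, i), m), ?_⟩
    simp only [j]
    rw [fermionMomenta_eq_of_umklappEq ha ((hshift _).symm.trans h₅)]

end NodalModes

/-! ### The nodal currents: identification with second quantizations and the current algebra. -/

section NodalOperators

open Classical ContinuousLinearMap

variable {L a : ℝ}

/-- b(y)Ω is zero or the one-hole state at y, so the expectation is an overlap of such states. It
identifies the vacuum subtraction with the sea occupation. -/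
theorem inner_vacuum_bilinear {X : Type} (e : X → ℝ) (x y : X) :
    ⟪(occVec ∅ : FockSpace X), star (fieldOp e x) (fieldOp e y (occVec ∅))⟫_ℂ =
      if x = y then seaOcc e x else 0 := by
  have h : ∀ z, fieldOp e z (occVec ∅) = if 0 < e z then 0 else occVec {z} := by
    intro z
    unfold fieldOp
    split_ifs
    · rw [annihilate_occVec, if_neg (Finset.notMem_empty z)]
    · rw [create_occVec, if_neg (Finset.notMem_empty z)]
      simp [jwSign]
  rw [star_eq_adjoint, adjoint_inner_right, h, h, seaOcc]
  by_cases hxy : x = y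
  · subst hxy
    rw [if_pos rfl]
    split_ifs
    · rw [inner_zero_left]
    · rw [inner_occVec_left, occVec_apply, if_pos rfl]
  · rw [if_neg hxy]
    split_ifs <;> simp [inner_occVec_left, occVec_apply, hxy]

theorem normalOrder_smul (c : ℂ) (O : NodalFock L a →L[ℂ] NodalFock L a) :
    normalOrder (c • O) = c • normalOrder O := by
  simp only [normalOrder, smul_apply, inner_smul_right, smul_sub, smul_smul]

theorem adjoint_smul_comp_smul {X : Type} (c : ℝ) (A B : FockSpace X →L[ℂ] FockSpace X) :
    adjoint ((c : ℂ) • A) ∘L ((c : ℂ) • B) = ((c ^ 2 : ℝ) : ℂ) • (star A * B) := by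
  rw [map_smulₛₗ, smul_comp, comp_smul, smul_smul, Complex.conj_ofReal, ← Complex.ofReal_mul,
    ← pow_two]
  rfl

theorem nodalFermion_eq (r s : ℤˣ) (α : Fin 2) (k : fermionMomenta L a s) :
    nodalFermion L a r s α k =
      ((L / (2 * Real.pi) : ℝ) : ℂ) • fieldOp modeEnergy (⟨r, s, α, k⟩ : NodalMode L a) := rfl

theorem normalOrder_star_mul (x y : NodalMode L a) :
    normalOrder (star (fieldOp modeEnergy x) * fieldOp modeEnergy y) =
      normalBilinear modeEnergy x y := by
  have h : ⟪diracVacuum L a, (star (fieldOp modeEnergy x) * fieldOp modeEnergy y)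
      (diracVacuum L a)⟫_ℂ = if x = y then seaOcc modeEnergy x else 0 :=
    inner_vacuum_bilinear modeEnergy x y
  rw [normalOrder, h]
  rfl

theorem normalOrder_nodalFermion (r s : ℤˣ) (α β : Fin 2) (k₁ k₂ : fermionMomenta L a s) :
    normalOrder (adjoint (nodalFermion L a r s α k₁) ∘L nodalFermion L a r s β k₂) =
      (((L / (2 * Real.pi)) ^ 2 : ℝ) : ℂ) •
        normalBilinear modeEnergy (⟨r, s, α, k₁⟩ : NodalMode L a) ⟨r, s, β, k₂⟩ := by
  rw [nodalFermion_eq, nodalFermion_eq, adjoint_smul_comp_smul, normalOrder_smul,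
    normalOrder_star_mul]

theorem bilinearTerm_eq (hL : 0 < L) (μ : Fin 4) (r s : ℤˣ) (p : ℤˣ → ℝ) (α β : Fin 2)
    (k₁ k₂ : fermionMomenta L a s) (n : ℤ) :
    bilinearTerm L a μ r s p (α, β, k₁, k₂, n) =
      if k₁.1 + p = k₂.1 + (2 * Real.pi * n / a) • unitVec (-s) then
        pauli μ α β • normalBilinear modeEnergy (⟨r, s, α, k₁⟩ : NodalMode L a) ⟨r, s, β, k₂⟩
      else 0 := by
  rw [bilinearTerm]
  refine if_congr Iff.rfl ?_ rfl
  rw [normalOrder_smul, normalOrder_nodalFermion, smul_smul, smul_smul]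
  congr 1
  have hpi := Real.pi_pos
  -- The prefactor of the current cancels the normalization of the two fermion fields.
  have h : (2 * Real.pi / L) ^ 2 * (L / (2 * Real.pi)) ^ 2 = 1 := by field_simp
  rw [mul_right_comm, ← Complex.ofReal_mul, h, Complex.ofReal_one, one_mul]

/-- The two momenta determine n, so nonzero terms of the two series correspond bijectively;
unconditional convergence is insensitive to this reindexing. -/
theorem hasSum_bilinearTerm_iff (hL : 0 < L) (ha : 0 < a) (μ : Fin 4) (r s : ℤˣ)
    (p : ℤˣ → ℝ) (φ v : NodalFock L a) :
    HasSum (fun q : NodalMode L a × NodalMode L a => nodalMatrix L a (pauli μ) r s p q.1 q.2 •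
      normalBilinear modeEnergy q.1 q.2 φ) v ↔
      HasSum (fun i => bilinearTerm L a μ r s p i φ) v := by
  have hne : ∀ {α β : Fin 2} {k₁ k₂ : fermionMomenta L a s} {n : ℤ},
      bilinearTerm L a μ r s p (α, β, k₁, k₂, n) φ ≠ 0 →
        k₁.1 + p = k₂.1 + (2 * Real.pi * n / a) • unitVec (-s) := by
    intro α β k₁ k₂ n h
    by_contra hc
    rw [bilinearTerm_eq hL, if_neg hc] at h
    exact h rfl
  refine hasSum_iff_hasSum_of_ne_zero_bij
    (fun i => (⟨r, s, i.1.1, i.1.2.2.1⟩, ⟨r, s, i.1.2.1, i.1.2.2.2.1⟩)) ?_ ?_ ?_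
  · rintro ⟨⟨α, β, k₁, k₂, n⟩, hi⟩ ⟨⟨α', β', k₁', k₂', n'⟩, hi'⟩ h
    simp only [Prod.mk.injEq, NodalMode.mk.injEq, heq_eq_eq, true_and] at h
    obtain ⟨⟨rfl, rfl⟩, rfl, rfl⟩ := h
    obtain rfl := umklapp_index_unique ha (hne hi) (hne hi')
    rfl
  · rintro ⟨⟨r₁, s₁, α, k₁⟩, ⟨r₂, s₂, β, k₂⟩⟩ hq
    have hU : nodalMatrix L a (pauli μ) r s p ⟨r₁, s₁, α, k₁⟩ ⟨r₂, s₂, β, k₂⟩ ≠ 0 :=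
      fun h => hq (by simp only [h, zero_smul])
    obtain ⟨⟨h₁, h₂⟩, ⟨h₃, h₄⟩, h₅⟩ := of_nodalMatrix_ne_zero hU
    simp only at h₁ h₂ h₃ h₄ h₅
    subst h₁ h₂ h₃ h₄
    obtain ⟨n, hn⟩ := id h₅
    refine ⟨⟨(α, β, k₁, k₂, n), ?_⟩, rfl⟩
    rw [Function.mem_support] at hq ⊢
    rw [bilinearTerm_eq hL, if_pos hn]
    simpa only [nodalMatrix, h₅, and_self, if_true, smul_apply] using hq
  · rintro ⟨⟨α, β, k₁, k₂, n⟩, hi⟩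
    have h := hne hi
    have h' : UmklappEq a s (k₁.1 + p) k₂.1 := ⟨n, h⟩
    simp only [bilinearTerm_eq hL, if_pos h, nodalMatrix, h', and_self, if_true]
    rfl

theorem bilinearSeries_eq (hL : 0 < L) (ha : 0 < a) (μ : Fin 4) (r s : ℤˣ) (p : ℤˣ → ℝ) :
    bilinearSeries L a μ r s p = quantOp modeEnergy (nodalMatrix L a (pauli μ) r s p) := by
  refine LinearPMap.ext ?_ ?_
  · ext φ
    exact ⟨fun ⟨v, hv⟩ => ⟨v, (hasSum_bilinearTerm_iff hL ha μ r s p φ v).mpr hv⟩,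
      fun ⟨v, hv⟩ => ⟨v, (hasSum_bilinearTerm_iff hL ha μ r s p φ v).mp hv⟩⟩
  · intro φ h₁ h₂
    exact ((hasSum_bilinearTerm_iff hL ha μ r s p φ _).mp (hasSum_quantOp _ _ ⟨φ, h₂⟩)).tsum_eq

theorem nodalCurrent_eq (hL : 0 < L) (ha : 0 < a) (μ : Fin 4) (r s : ℤˣ) (p : ℤˣ → ℝ) :
    nodalCurrent L a μ r s p =
      (quantOp modeEnergy (nodalMatrix L a (pauli μ) r s p)).closure := by
  rw [nodalCurrent, bilinearSeries_eq hL ha]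

theorem pauli_conjTranspose (μ : Fin 4) : (pauli μ).conjTranspose = pauli μ := by
  fin_cases μ <;> ext i j <;> fin_cases i <;> fin_cases j <;>
    simp [pauli, Matrix.conjTranspose_apply]

theorem pauli_zero : pauli 0 = 1 := rfl

theorem trace_pauli_succ (i : Fin 3) : (pauli i.succ).trace = 0 := by
  fin_cases i <;> simp [pauli, Matrix.trace]

theorem trace_pauli_mul (i j : Fin 3) :
    (pauli i.succ * pauli j.succ).trace = if i = j then 2 else 0 := by
  fin_cases i <;> fin_cases j <;> simp [pauli, Matrix.trace_fin_two] <;> norm_num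

theorem pauli_comm (i j : Fin 3) :
    pauli i.succ * pauli j.succ - pauli j.succ * pauli i.succ =
      ∑ k : Fin 3, (2 * Complex.I * leviCivita i j k) • pauli k.succ := by
  fin_cases i <;> fin_cases j <;> ext x y <;> fin_cases x <;> fin_cases y <;>
    simp [pauli, leviCivita, Fin.sum_univ_three] <;> ring_nf <;> simp

theorem act_smul {E : Type} [AddCommGroup E] [Module ℂ E] (c : ℂ) (A : E →ₗ.[ℂ] E) (φ : E) :
    act (c • A) φ = c • act A φ := by
  unfold act
  by_cases h : φ ∈ A.domain
  · rw [dif_pos h, dif_pos (show φ ∈ (c • A).domain from h), LinearPMap.smul_apply]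
  -- Scaling leaves the domain unchanged, and outside it both sides have the default value 0.
  · rw [dif_neg h, dif_neg (show φ ∉ (c • A).domain from h), smul_zero]

theorem secondQuant_smul {X : Type} (e : X → ℝ) (U : X → X → ℂ) (c : ℂ) (φ : FockSpace X) :
    secondQuant e U (c • φ) = c • secondQuant e U φ := by
  simp only [secondQuant, map_smul, smul_comm _ c]
  exact tsum_const_smul'' c

theorem secondQuant_zero {X : Type} (e : X → ℝ) (φ : FockSpace X) :
    secondQuant e (fun _ _ => 0) φ = 0 := by
  simp [secondQuant]

variable (hL : 0 < L) (ha : 0 < a) {M : ℕ} (hM0 : 0 < M) (hM : L = M * a)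

/-- The nodal current of a vector with finitely many excitations depends linearly on the spin
matrix. -/
def nodalQuant (r s : ℤˣ) (p : ℤˣ → ℝ) (φ : finiteVectors (NodalMode L a)) :
    Matrix (Fin 2) (Fin 2) ℂ →ₗ[ℂ] NodalFock L a where
  toFun σ := secondQuant modeEnergy (nodalMatrix L a σ r s p) φ
  map_add' σ τ := by
    have he := finite_modeEnergy_le (L := L) (a := a) hL ha hM0 hM
    rw [secondQuant, secondQuant, secondQuant, ← Summable.tsum_add
      (summable_secondQuant he (shiftsBy_nodalMatrix σ r s p) φ.2)
      (summable_secondQuant he (shiftsBy_nodalMatrix τ r s p) φ.2)]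
    refine tsum_congr fun q => ?_
    rw [← add_smul, nodalMatrix, nodalMatrix, nodalMatrix]
    split_ifs <;> simp
  map_smul' c σ := by
    rw [secondQuant, secondQuant, RingHom.id_apply, ← tsum_const_smul'']
    refine tsum_congr fun q => ?_
    rw [smul_smul, nodalMatrix, nodalMatrix]
    split_ifs <;> simp

theorem nodalQuant_apply (r s : ℤˣ) (p : ℤˣ → ℝ) (φ : finiteVectors (NodalMode L a))
    (σ : Matrix (Fin 2) (Fin 2) ℂ) :
    nodalQuant hL ha hM0 hM r s p φ σ =
      secondQuant modeEnergy (nodalMatrix L a σ r s p) φ := rfl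

include hL ha hM0 hM

theorem nodalCurrent_act (μ : Fin 4) (r s : ℤˣ) (p : ℤˣ → ℝ) {φ : NodalFock L a}
    (hφ : φ ∈ finiteVectors (NodalMode L a)) :
    act (nodalCurrent L a μ r s p) φ =
      secondQuant modeEnergy (nodalMatrix L a (pauli μ) r s p) φ := by
  rw [nodalCurrent_eq hL ha, act_quantOp_closure (finite_modeEnergy_le hL ha hM0 hM)
    (shiftsBy_nodalMatrix _ r s p) hφ]

theorem nodalCurrent_act_mem (μ : Fin 4) (r s : ℤˣ) (p : ℤˣ → ℝ) {φ : NodalFock L a}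
    (hφ : φ ∈ finiteVectors (NodalMode L a)) :
    act (nodalCurrent L a μ r s p) φ ∈ finiteVectors (NodalMode L a) := by
  rw [nodalCurrent_act hL ha hM0 hM μ r s p hφ]
  exact secondQuant_mem_finiteVectors (finite_modeEnergy_le hL ha hM0 hM)
    (shiftsBy_nodalMatrix _ r s p) hφ

theorem mem_nodalCurrent_domain (μ : Fin 4) (r s : ℤˣ) (p : ℤˣ → ℝ) {φ : NodalFock L a}
    (hφ : φ ∈ finiteVectors (NodalMode L a)) : φ ∈ (nodalCurrent L a μ r s p).domain := by
  rw [nodalCurrent_eq hL ha]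
  exact mem_closure_domain (finite_modeEnergy_le hL ha hM0 hM) (shiftsBy_nodalMatrix _ r s p) hφ

theorem nodalCurrent_adjoint (μ : Fin 4) (r s : ℤˣ) (p : ℤˣ → ℝ) :
    (nodalCurrent L a μ r s p).adjoint = nodalCurrent L a μ r s (-p) := by
  rw [nodalCurrent_eq hL ha, nodalCurrent_eq hL ha, quantOp_closure_adjoint
    (finite_modeEnergy_le hL ha hM0 hM) (shiftsBy_nodalMatrix _ r s p), conjMatrix_nodalMatrix,
    pauli_conjTranspose]

theorem dense_nodalCurrent_domain (μ : Fin 4) (r s : ℤˣ) (p : ℤˣ → ℝ) :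
    Dense ((nodalCurrent L a μ r s p).domain : Set (NodalFock L a)) :=
  dense_finiteVectors.mono fun _ hφ => mem_nodalCurrent_domain hL ha hM0 hM μ r s p hφ

theorem commAt_nodalCurrent (μ ν : Fin 4) (r s : ℤˣ) {p p' : ℤˣ → ℝ} (hp : p ∈ bosonMomenta L)
    (hp' : p' ∈ bosonMomenta L) {φ : NodalFock L a} (hφ : φ ∈ finiteVectors (NodalMode L a)) :
    commAt (nodalCurrent L a μ r s p) (nodalCurrent L a ν r s p') φ =
      nodalQuant hL ha hM0 hM r s (p + p') ⟨φ, hφ⟩ (pauli μ * pauli ν - pauli ν * pauli μ) +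
      ((pauli μ * pauli ν).trace *
        (((((r : ℤ) : ℝ) * p s * (L / (2 * Real.pi)) * (L / a) : ℝ) : ℂ) *
          umklappDelta a s (p + p'))) • φ := by
  have h := secondQuant_comm (finite_modeEnergy_le hL ha hM0 hM)
    (shiftsBy_nodalMatrix (pauli μ) r s p) (shiftsBy_nodalMatrix (pauli ν) r s p')
    (hasSum_nodalMatrix_mul hL ha hM (pauli μ) (pauli ν) r s hp p')
    (hasSum_nodalMatrix_mul hL ha hM (pauli ν) (pauli μ) r s hp' p)
    (hasSum_schwinger hL ha hM0 hM (pauli μ) (pauli ν) r s hp p') hφ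
  rw [commAt, nodalCurrent_act hL ha hM0 hM μ r s p (nodalCurrent_act_mem hL ha hM0 hM ν r s p' hφ),
    nodalCurrent_act hL ha hM0 hM ν r s p' (nodalCurrent_act_mem hL ha hM0 hM μ r s p hφ),
    nodalCurrent_act hL ha hM0 hM ν r s p' hφ, nodalCurrent_act hL ha hM0 hM μ r s p hφ, h,
    map_sub, nodalQuant_apply, nodalQuant_apply, add_comm p' p]

/-- The matrices live on disjoint blocks of modes, so both products and the Schwinger term vanish.
-/
theorem commAt_nodalCurrent_of_ne (μ ν : Fin 4) {r s r' s' : ℤˣ} (hrs : (r, s) ≠ (r', s'))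
    (p p' : ℤˣ → ℝ) {φ : NodalFock L a} (hφ : φ ∈ finiteVectors (NodalMode L a)) :
    commAt (nodalCurrent L a μ r s p) (nodalCurrent L a ν r' s' p') φ = 0 := by
  have h := secondQuant_comm (W := fun _ _ => 0) (W' := fun _ _ => 0) (κ := 0)
    (finite_modeEnergy_le hL ha hM0 hM)
    (shiftsBy_nodalMatrix (pauli μ) r s p) (shiftsBy_nodalMatrix (pauli ν) r' s' p')
    (fun x w => by simpa only [nodalMatrix_mul_eq_zero hrs] using hasSum_zero)
    (fun x w => by simpa only [nodalMatrix_mul_eq_zero hrs.symm] using hasSum_zero)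
    (by simpa only [nodalMatrix_mul_eq_zero hrs, zero_mul] using hasSum_zero) hφ
  rw [commAt, nodalCurrent_act hL ha hM0 hM μ r s p
      (nodalCurrent_act_mem hL ha hM0 hM ν r' s' p' hφ),
    nodalCurrent_act hL ha hM0 hM ν r' s' p' (nodalCurrent_act_mem hL ha hM0 hM μ r s p hφ),
    nodalCurrent_act hL ha hM0 hM ν r' s' p' hφ, nodalCurrent_act hL ha hM0 hM μ r s p hφ, h,
    secondQuant_zero, sub_zero, zero_smul, add_zero]

theorem act_nodalCurrent_smul (μ : Fin 4) (r s : ℤˣ) (p : ℤˣ → ℝ) (c : ℂ) {φ : NodalFock L a}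
    (hφ : φ ∈ finiteVectors (NodalMode L a)) :
    act (nodalCurrent L a μ r s p) (c • φ) = c • act (nodalCurrent L a μ r s p) φ := by
  rw [nodalCurrent_act hL ha hM0 hM μ r s p (Submodule.smul_mem _ _ hφ),
    nodalCurrent_act hL ha hM0 hM μ r s p hφ, secondQuant_smul]

theorem commAt_smul_smul (μ ν : Fin 4) (r s r' s' : ℤˣ) (p p' : ℤˣ → ℝ) (c d : ℂ)
    {φ : NodalFock L a} (hφ : φ ∈ finiteVectors (NodalMode L a)) :
    commAt (c • nodalCurrent L a μ r s p) (d • nodalCurrent L a ν r' s' p') φ =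
      (c * d) • commAt (nodalCurrent L a μ r s p) (nodalCurrent L a ν r' s' p') φ := by
  simp only [commAt, act_smul]
  rw [act_nodalCurrent_smul hL ha hM0 hM μ r s p d
      (nodalCurrent_act_mem hL ha hM0 hM ν r' s' p' hφ),
    act_nodalCurrent_smul hL ha hM0 hM ν r' s' p' c (nodalCurrent_act_mem hL ha hM0 hM μ r s p hφ),
    smul_smul, smul_smul, smul_sub, mul_comm d c]

theorem nodalCurrent_vacuum (μ : Fin 4) (r s : ℤˣ) {p : ℤˣ → ℝ}
    (hp : 0 ≤ ((r : ℤ) : ℝ) * p s) :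
    act (nodalCurrent L a μ r s p) (diracVacuum L a) = 0 := by
  rw [diracVacuum, nodalCurrent_act hL ha hM0 hM μ r s p (occVec_mem_finiteVectors ∅)]
  exact secondQuant_vacuum (shiftsBy_nodalMatrix _ r s p) (neg_nonpos.mpr hp)

theorem nodalDensity_comm (r s : ℤˣ) {p p' : ℤˣ → ℝ} (hp : p ∈ bosonMomenta L)
    (hp' : p' ∈ bosonMomenta L) {φ : NodalFock L a} (hφ : φ ∈ finiteVectors (NodalMode L a)) :
    commAt (nodalDensity L a r s p) (nodalDensity L a r s p') φ =
      ((((r : ℤ) : ℝ) * (4 * Real.pi * p s / a) * (L / (2 * Real.pi)) ^ 2 : ℝ) : ℂ) •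
        umklappDelta a s (p + p') • φ := by
  rw [nodalDensity, nodalDensity, commAt_nodalCurrent hL ha hM0 hM 0 0 r s hp hp' hφ, sub_self,
    map_zero, zero_add, smul_smul, ← mul_assoc]
  congr 2
  have hpi := Real.pi_pos
  -- The factor 2 is the trace of the identity spin matrix.
  have h : ((r : ℤ) : ℝ) * (4 * Real.pi * p s / a) * (L / (2 * Real.pi)) ^ 2 =
      2 * (((r : ℤ) : ℝ) * p s * (L / (2 * Real.pi)) * (L / a)) := by
    field_simp
    ring
  rw [h, pauli_zero, mul_one, Matrix.trace_one, Fintype.card_fin]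
  push_cast
  ring

theorem nodalSpin_comm (r s : ℤˣ) (i j : Fin 3) {p p' : ℤˣ → ℝ} (hp : p ∈ bosonMomenta L)
    (hp' : p' ∈ bosonMomenta L) {φ : NodalFock L a} (hφ : φ ∈ finiteVectors (NodalMode L a)) :
    commAt (nodalSpin L a i r s p) (nodalSpin L a j r s p') φ =
      (Complex.I • ∑ k : Fin 3, leviCivita i j k • act (nodalSpin L a k r s (p + p')) φ) +
        (if i = j then (1 : ℂ) else 0) •
          ((((r : ℤ) : ℝ) * (Real.pi * p s / a) * (L / (2 * Real.pi)) ^ 2 : ℝ) : ℂ) •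
            umklappDelta a s (p + p') • φ := by
  unfold nodalSpin
  rw [commAt_smul_smul hL ha hM0 hM _ _ r s r s p p' _ _ hφ,
    commAt_nodalCurrent hL ha hM0 hM _ _ r s hp hp' hφ, pauli_comm, trace_pauli_mul, smul_add,
    map_sum]
  congr 1
  · rw [Finset.smul_sum, Finset.smul_sum]
    refine Finset.sum_congr rfl fun k _ => ?_
    rw [act_smul, nodalCurrent_act hL ha hM0 hM _ r s _ hφ, map_smul, nodalQuant_apply]
    simp only [smul_smul]
    congr 1
    ring
  · simp only [smul_smul]
    congr 1
    have hpi := Real.pi_pos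
    -- The factor 1/2 combines tr(σ^i σ^i) = 2 with the two spin normalizations 1/2.
    have h : ((r : ℤ) : ℝ) * (Real.pi * p s / a) * (L / (2 * Real.pi)) ^ 2 =
        1 / 2 * (((r : ℤ) : ℝ) * p s * (L / (2 * Real.pi)) * (L / a)) := by
      field_simp
    rw [h]
    split_ifs
    · push_cast
      ring
    · simp

theorem nodalDensity_comm_nodalSpin (r s r' s' : ℤˣ) (i : Fin 3) {p p' : ℤˣ → ℝ}
    (hp : p ∈ bosonMomenta L) (hp' : p' ∈ bosonMomenta L) {φ : NodalFock L a}
    (hφ : φ ∈ finiteVectors (NodalMode L a)) :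
    commAt (nodalDensity L a r s p) (nodalSpin L a i r' s' p') φ = 0 := by
  have h := commAt_smul_smul hL ha hM0 hM 0 i.succ r s r' s' p p' 1 (1 / 2) hφ
  rw [one_smul] at h
  rw [nodalDensity, nodalSpin, h]
  -- On the same block the identity commutes with σ^i, and the Schwinger term vanishes because σ^i
  -- is traceless.
  by_cases hrs : (r, s) = (r', s')
  · obtain ⟨rfl, rfl⟩ := Prod.mk.inj hrs
    rw [commAt_nodalCurrent hL ha hM0 hM _ _ r s hp hp' hφ, pauli_zero, one_mul (pauli i.succ), mul_one (pauli i.succ),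
      sub_self, map_zero, trace_pauli_succ, zero_mul, zero_smul, add_zero, smul_zero]
  · rw [commAt_nodalCurrent_of_ne hL ha hM0 hM _ _ hrs p p' hφ, smul_zero]

theorem nodalSpin_comm_of_ne {r s r' s' : ℤˣ} (hrs : (r, s) ≠ (r', s')) (i j : Fin 3)
    (p p' : ℤˣ → ℝ) {φ : NodalFock L a} (hφ : φ ∈ finiteVectors (NodalMode L a)) :
    commAt (nodalSpin L a i r s p) (nodalSpin L a j r' s' p') φ = 0 := by
  rw [nodalSpin, nodalSpin, commAt_smul_smul hL ha hM0 hM _ _ r s r' s' p p' _ _ hφ,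
    commAt_nodalCurrent_of_ne hL ha hM0 hM _ _ hrs p p' hφ, smul_zero]

theorem nodalSpin_adjoint (i : Fin 3) (r s : ℤˣ) (p : ℤˣ → ℝ) :
    (nodalSpin L a i r s p).adjoint = nodalSpin L a i r s (-p) := by
  rw [nodalSpin, LinearPMap.adjoint_smul (dense_nodalCurrent_domain hL ha hM0 hM _ r s p)
    (by norm_num), nodalCurrent_adjoint hL ha hM0 hM, nodalSpin]
  congr 1
  simpa using Complex.conj_ofReal (1 / 2)

end NodalOperators

end

theorem propositionC1 (L a : ℝ) (hL : 0 < L) (ha : 0 < a) (hLa : ∃ M : ℕ, L = M * a) :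
    -- the density and spin operators are well defined, with common invariant core
    (Dense (finiteExcitations L a : Set (NodalFock L a)) ∧
      diracVacuum L a ∈ finiteExcitations L a ∧
      (∀ (μ : Fin 4) (r s : ℤˣ), ∀ p ∈ bosonMomenta L,
        finiteExcitations L a ≤ (bilinearSeries L a μ r s p).domain ∧
        (bilinearSeries L a μ r s p).IsClosable ∧
        (nodalCurrent L a μ r s p).HasCore (finiteExcitations L a)) ∧
      (∀ (r s : ℤˣ), ∀ p ∈ bosonMomenta L, ∀ φ ∈ finiteExcitations L a,
        φ ∈ (nodalDensity L a r s p).domain ∧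
        act (nodalDensity L a r s p) φ ∈ finiteExcitations L a ∧
        ∀ i : Fin 3, φ ∈ (nodalSpin L a i r s p).domain ∧
          act (nodalSpin L a i r s p) φ ∈ finiteExcitations L a)) ∧
    -- commutation relations
    (∀ p ∈ bosonMomenta L, ∀ p' ∈ bosonMomenta L, ∀ φ ∈ finiteExcitations L a,
      (∀ r s : ℤˣ,
        commAt (nodalDensity L a r s p) (nodalDensity L a r s p') φ =
          ((((r : ℤ) : ℝ) * (4 * Real.pi * p s / a) * (L / (2 * Real.pi)) ^ 2 : ℝ) : ℂ) •
            umklappDelta a s (p + p') • φ) ∧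
      (∀ (r s : ℤˣ) (i j : Fin 3),
        commAt (nodalSpin L a i r s p) (nodalSpin L a j r s p') φ =
          (Complex.I • ∑ k : Fin 3, leviCivita i j k • act (nodalSpin L a k r s (p + p')) φ) +
          (if i = j then (1 : ℂ) else 0) •
            ((((r : ℤ) : ℝ) * (Real.pi * p s / a) * (L / (2 * Real.pi)) ^ 2 : ℝ) : ℂ) •
              umklappDelta a s (p + p') • φ) ∧
      (∀ (r s r' s' : ℤˣ) (i : Fin 3),
        commAt (nodalDensity L a r s p) (nodalSpin L a i r' s' p') φ = 0) ∧
      (∀ r s r' s' : ℤˣ, (r, s) ≠ (r', s') →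
        commAt (nodalDensity L a r s p) (nodalDensity L a r' s' p') φ = 0 ∧
        ∀ i j : Fin 3, commAt (nodalSpin L a i r s p) (nodalSpin L a j r' s' p') φ = 0)) ∧
    -- adjoints
    (∀ (r s : ℤˣ), ∀ p ∈ bosonMomenta L,
      (nodalDensity L a r s p).adjoint = nodalDensity L a r s (-p) ∧
      ∀ i : Fin 3, (nodalSpin L a i r s p).adjoint = nodalSpin L a i r s (-p)) ∧
    -- highest weight condition
    (∀ (r s : ℤˣ), ∀ p ∈ bosonMomenta L, 0 ≤ ((r : ℤ) : ℝ) * p s →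
      act (nodalDensity L a r s p) (diracVacuum L a) = 0 ∧
      ∀ i : Fin 3, act (nodalSpin L a i r s p) (diracVacuum L a) = 0) := by
  obtain ⟨M, hM⟩ := hLa
  have hM0 : 0 < M := Nat.pos_of_ne_zero fun h => hL.ne' (by rw [hM, h, Nat.cast_zero, zero_mul])
  refine ⟨⟨dense_finiteVectors, occVec_mem_finiteVectors ∅, fun μ r s p _ => ?_,
    fun r s p _ φ hφ => ⟨mem_nodalCurrent_domain hL ha hM0 hM _ r s p hφ,
      nodalCurrent_act_mem hL ha hM0 hM _ r s p hφ, fun i => ⟨?_, ?_⟩⟩⟩,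
    fun p hp p' hp' φ hφ => ⟨fun r s => nodalDensity_comm hL ha hM0 hM r s hp hp' hφ,
      fun r s i j => nodalSpin_comm hL ha hM0 hM r s i j hp hp' hφ,
      fun r s r' s' i => nodalDensity_comm_nodalSpin hL ha hM0 hM r s r' s' i hp hp' hφ,
      fun r s r' s' hrs => ⟨commAt_nodalCurrent_of_ne hL ha hM0 hM 0 0 hrs p p' hφ,
        fun i j => nodalSpin_comm_of_ne hL ha hM0 hM hrs i j p p' hφ⟩⟩,
    fun r s p _ => ⟨nodalCurrent_adjoint hL ha hM0 hM 0 r s p,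
      fun i => nodalSpin_adjoint hL ha hM0 hM i r s p⟩,
    fun r s p _ h => ⟨nodalCurrent_vacuum hL ha hM0 hM 0 r s h, fun i => ?_⟩⟩
  · have he := finite_modeEnergy_le (L := L) (a := a) hL ha hM0 hM
    have hU := shiftsBy_nodalMatrix (L := L) (a := a) (pauli μ) r s p
    rw [nodalCurrent_eq hL ha, bilinearSeries_eq hL ha]
    exact ⟨finiteVectors_le_domain he hU, quantOp_isClosable he hU, quantOp_hasCore he hU⟩
  · exact mem_nodalCurrent_domain hL ha hM0 hM _ r s p hφ
  · rw [nodalSpin, act_smul]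
    exact Submodule.smul_mem _ _ (nodalCurrent_act_mem hL ha hM0 hM _ r s p hφ)
  · rw [nodalSpin, act_smul, nodalCurrent_vacuum hL ha hM0 hM _ r s h, smul_zero]
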